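/- For nonnegative integers $n,s$ let $\mathrm{ex}(n,s)$ denote the maximum number of edges of a triangle-free graph on $n$ vertices whose independence number is at most $s$. For an integer $k\ge 1$ the Andrásfai graph $\Gamma_k$ is the graph with vertex set $\mathbb Z/(3k-1)\mathbb Z$ in which $i$ and $j$ are adjacent if and only if $i-j\in\{k,k+1,\dots,2k-1\}$. For $k\ge 2$ put $$g_k(n,s)=\tfrac12 k(k-1)n^2-k(3k-4)ns+\tfrac12(3k-4)(3k-1)s^2 .$$ When $\frac{4n}{11}\le s\le\frac{3n}{8}$, let $G(n;4,s)$ be the graph obtained from $\Gamma_4$ by replacing each of the vertices $1,4,8$ by an independent set of $3n-8s$ vertices, each of the remaining eight vertices by an independent set of $3s-n$ vertices, and each edge of $\Gamma_4$ by all edges between the two corresponding sets. **Theorem 1.2.** For all integers $n,s$ with $\frac{4n}{11}\le s\le \frac{3n}{8}$ we have $$\mathrm{ex}(n,s)=g_4(n,s)=6n^2-32ns+44s^2 ,$$ and $G(n;4,s)$ is a triangle-free graph on $n$ vertices with independence number at most $s$ and exactly $\mathrm{ex}(n,s)$ edges. In particular, the case $k=4$ of Andrásfai's conjecture holds, where the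 conjecture asserts for an integer $k\ge 2$ that $\mathrm{ex}(n,s)=g_k(n,s)$ for all integers $n,s$ with $\frac{kn}{3k-1}\le s\le\frac{(k-1)n}{3k-4}$. -/

import Mathlib

namespace RamseyTuran

/-- The possible numbers of edges of a triangle-free graph on `n` vertices in which every
independent set has at most `s` vertices. -/
def edgeCounts (n s : ℕ) : Set ℕ :=
  {e | ∃ G : SimpleGraph (Fin n), G.CliqueFree 3 ∧ G.indepNum ≤ s ∧ G.edgeSet.ncard = e}

/-- `ex n s` is the maximum number of edges of a triangle-free graph on `n` vertices with
independence number at most `s`. It is an honest maximum whenever such a graph exists, see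
`isGreatest_ex`. -/
noncomputable def ex (n s : ℕ) : ℕ := sSup (edgeCounts n s)

/-- As soon as one admissible graph exists, `ex n s` is the greatest admissible edge count. -/
theorem isGreatest_ex {n s : ℕ} (h : (edgeCounts n s).Nonempty) :
    IsGreatest (edgeCounts n s) (ex n s) := by
  have hb : BddAbove (edgeCounts n s) := by
    refine ⟨Nat.card (Sym2 (Fin n)), ?_⟩
    rintro e ⟨G, -, -, rfl⟩
    exact Set.ncard_le_card _
  exact ⟨Nat.sSup_mem h hb, fun _ he => le_csSup hb he⟩

/-- `G` belongs to the family of extremal graphs for `n` and `s`: it is a triangle-free graph on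
`n` vertices with independence number at most `s` and with exactly `ex n s` edges. -/
structure IsExtremal {V : Type*} (G : SimpleGraph V) (n s : ℕ) : Prop where
  finite : Finite V
  card_eq : Nat.card V = n
  cliqueFree : G.CliqueFree 3
  indepNum_le : G.indepNum ≤ s
  card_edges : G.edgeSet.ncard = ex n s

/-- The Andrásfai graph `Γ_k` (for `k ≥ 1`): the Cayley graph of `ℤ/(3k-1)ℤ` with connection set
`{k, k+1, …, 2k-1}`. -/
def andrasfaiGraph (k : ℕ) : SimpleGraph (ZMod (3 * k - 1)) :=
  SimpleGraph.circulantGraph {x | ∃ d ∈ Finset.Icc k (2 * k - 1), x = (d : ZMod (3 * k - 1))}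

/-- The blow-up of `G` in which each vertex `v` is replaced by an independent set of `m v`
vertices, and each edge by a complete bipartite graph. -/
def blowUp {V : Type*} (G : SimpleGraph V) (m : V → ℕ) : SimpleGraph (Σ v : V, Fin (m v)) :=
  G.comap Sigma.fst

/-- The class sizes of the canonical blow-up of `Γ_k`: the vertices `1`, `k`, `2k` get
`(k-1)n - (3k-4)s` vertices each, all others get `3s - n` vertices each. (These numbers are
nonnegative in the range where the canonical blow-up is considered.) -/
def canonicalSize (n k s : ℕ) (v : ZMod (3 * k - 1)) : ℕ :=
  if v = 1 ∨ v = (k : ZMod (3 * k - 1)) ∨ v = ((2 * k : ℕ) : ZMod (3 * k - 1)) then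
    (((k : ℤ) - 1) * n - (3 * k - 4) * s).toNat
  else (3 * (s : ℤ) - n).toNat

/-- The canonical blow-up `G(n; k, s)` of the Andrásfai graph `Γ_k`. -/
def canonicalBlowUp (n k s : ℕ) : SimpleGraph (Σ v : ZMod (3 * k - 1), Fin (canonicalSize n k s v)) :=
  blowUp (andrasfaiGraph k) (canonicalSize n k s)

/-- The polynomial `g_k(n, s) = k(k-1)n²/2 - k(3k-4)ns + (3k-4)(3k-1)s²/2`. -/
def g (k n s : ℕ) : ℚ :=
  (1 / 2) * k * (k - 1) * n ^ 2 - k * (3 * k - 4) * n * s + (1 / 2) * (3 * k - 4) * (3 * k - 1) * s ^ 2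

/-- The assertion of Andrásfai's conjecture for a given `k`: `ex(n, s) = g_k(n, s)` for all `n`, `s`
with `kn/(3k-1) ≤ s ≤ (k-1)n/(3k-4)`. -/
def AndrasfaiConjectureFor (k : ℕ) : Prop :=
  ∀ n s : ℕ, (k : ℚ) * n / (3 * k - 1) ≤ s → (s : ℚ) ≤ (k - 1) * n / (3 * k - 4) →
    (ex n s : ℚ) = g k n s

end RamseyTuran

/-! After division by `n` the upper bound concerns triangle-free graphs with a probability weight:
independence ratio `s` in `[4/11, 3/8]` should force `adjForm H w w ≤ density s`. Suppose this
fails, and take a weighted graph whose excess over `density` is nearly the supremum of all excesses.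
Moving its weight slightly towards any weight on `coneGraph H` gains almost nothing. To first order
this bounds a linear functional of the new weight by its independence ratio, and the minimax lemma
turns the bound into a single distribution `p` on nearly maximum independent sets (`exists_isDual`).
The cone vertices transfer the degree conditions to these sets: each is disjoint from a proportion
of at least about `κ` of the others, where `4/11 < κ < 3/8`.

The disjointness graph on these sets is triangle-free because `s > 1/3`. An uncrossing argument
shows that it is almost `κ`-regular and that almost every non-neighbour of a vertex has many common
neighbours with it (`exists_isRegularSystem`).

No such graph exists (`IsRegularSystem.elim`). Two adjacent vertices and a typical common
non-neighbour extend to a pentagon. But counting the members of a configuration that a vertex can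
see excludes the Wagner graph, then the Wagner graph minus an edge, then the pentagon. Each
exclusion comes down to `11 κ ≤ 4` up to small errors.

For the lower bound, the order, independence number and size of the canonical blow-up reduce to
finite checks in the Andrásfai graph on eleven vertices. -/

namespace RamseyTuran

/-! ### Masses of sets with respect to a weight function -/

section Mass

variable {α : Type*} [Fintype α]

/-- The total weight of a set with respect to a real weight function on a finite type. -/
noncomputable def mass (p : α → ℝ) (A : Set α) : ℝ := ∑ x, A.indicator p x

theorem mass_nonneg {p : α → ℝ} (hp : ∀ x, 0 ≤ p x) (A : Set α) : 0 ≤ mass p A :=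
  Finset.sum_nonneg fun x _ => Set.indicator_nonneg (fun y _ => hp y) x

theorem mass_mono {p : α → ℝ} (hp : ∀ x, 0 ≤ p x) {A B : Set α} (h : A ⊆ B) :
    mass p A ≤ mass p B :=
  Finset.sum_le_sum fun x _ => Set.indicator_le_indicator_of_subset h hp x

theorem mass_univ (p : α → ℝ) : mass p Set.univ = ∑ x, p x := by simp [mass]

theorem mass_empty (p : α → ℝ) : mass p ∅ = 0 := by simp [mass]

theorem mass_le_univ {p : α → ℝ} (hp : ∀ x, 0 ≤ p x) (A : Set α) : mass p A ≤ ∑ x, p x :=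
  mass_univ p ▸ mass_mono hp (Set.subset_univ A)

theorem mass_union_add_inter (p : α → ℝ) (A B : Set α) :
    mass p (A ∪ B) + mass p (A ∩ B) = mass p A + mass p B := by
  simp only [mass, ← Finset.sum_add_distrib]
  exact Finset.sum_congr rfl fun x _ => Set.indicator_union_add_inter_apply p A B x

theorem mass_union_le {p : α → ℝ} (hp : ∀ x, 0 ≤ p x) (A B : Set α) :
    mass p (A ∪ B) ≤ mass p A + mass p B := by
  linarith [mass_union_add_inter p A B, mass_nonneg hp (A ∩ B)]

theorem mass_union_of_disjoint (p : α → ℝ) {A B : Set α} (h : Disjoint A B) :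
    mass p (A ∪ B) = mass p A + mass p B := by
  have := mass_union_add_inter p A B
  rw [h.inter_eq, mass_empty] at this
  linarith

theorem mass_add_compl (p : α → ℝ) (A : Set α) : mass p A + mass p Aᶜ = ∑ x, p x := by
  rw [← mass_union_of_disjoint p disjoint_compl_right, Set.union_compl_self, mass_univ]

theorem mass_inter_add_diff (p : α → ℝ) (A B : Set α) :
    mass p (A ∩ B) + mass p (A \ B) = mass p A := by
  rw [← mass_union_of_disjoint p (Set.disjoint_sdiff_inter.symm), Set.inter_union_sdiff]

theorem mass_add_le {p : α → ℝ} (hp : ∀ x, 0 ≤ p x) {A B : Set α} (h : Disjoint A B) :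
    mass p A + mass p B ≤ ∑ x, p x := by
  rw [← mass_union_of_disjoint p h]
  exact mass_le_univ hp _

theorem nonempty_of_mass_pos {p : α → ℝ} {A : Set α} (h : 0 < mass p A) : A.Nonempty := by
  by_contra hA
  rw [Set.not_nonempty_iff_eq_empty] at hA
  simp [hA, mass_empty] at h

theorem mass_eq_sum_mul (p : α → ℝ) (A : Set α) :
    mass p A = ∑ x, p x * A.indicator 1 x := by
  refine Finset.sum_congr rfl fun x _ => ?_
  by_cases hx : x ∈ A <;> simp [hx]

/-- Double counting: averaging the weights of the sets `S x` is the same as weighting each element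
by the mass of the sets containing it. -/
theorem sum_mul_mass_comm {β : Type*} [Fintype β] (p : α → ℝ) (w : β → ℝ) (S : α → Set β) :
    ∑ x, p x * mass w (S x) = ∑ y, w y * mass p {x | y ∈ S x} := by
  simp only [mass_eq_sum_mul, Finset.mul_sum]
  rw [Finset.sum_comm]
  refine Finset.sum_congr rfl fun y _ => Finset.sum_congr rfl fun x _ => ?_
  by_cases h : y ∈ S x <;> simp [h, mul_comm]

end Mass

/-! ### A minimax lemma -/

/-- A form of von Neumann's minimax theorem for finite games. -/
theorem exists_mixed_strategy {A B : Type*} [Fintype A] [Fintype B] [Nonempty A] (a : A → B → ℝ)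
    (c : ℝ) (h : ∀ w ∈ stdSimplex ℝ A, ∃ b, ∑ v, w v * a v b ≤ c) :
    ∃ p ∈ stdSimplex ℝ B, ∀ v, ∑ b, p b * a v b ≤ c := by
  classical
  let T : (B → ℝ) →ₗ[ℝ] (A → ℝ) :=
    { toFun := fun p v => ∑ b, p b * a v b
      map_add' := fun p q => by
        ext v; simp [add_mul, Finset.sum_add_distrib]
      map_smul' := fun r p => by
        ext v; simp [mul_assoc, Finset.mul_sum] }
  by_contra hcon
  push Not at hcon
  have hB : Nonempty B := by
    obtain ⟨b, -⟩ := h (Pi.single (Classical.arbitrary A) 1) (single_mem_stdSimplex ℝ _)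
    exact ⟨b⟩
  have hconv : Convex ℝ (T '' stdSimplex ℝ B) := (convex_stdSimplex ℝ B).linear_image T
  have hcomp : IsCompact (T '' stdSimplex ℝ B) :=
    (isCompact_stdSimplex ℝ B).image T.continuous_of_finiteDimensional
  have hQ : Convex ℝ (Set.Iic (fun _ : A => c)) := convex_Iic _
  have hdisj : Disjoint (T '' stdSimplex ℝ B) (Set.Iic (fun _ : A => c)) := by
    rw [Set.disjoint_left]
    rintro _ ⟨p, hp, rfl⟩ hle
    obtain ⟨v, hv⟩ := hcon p hp
    exact absurd (hle v) (not_le.2 hv)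
  -- If no mixed strategy works, the compact set of achievable payoff vectors misses the closed
  -- orthant below `c`. The coefficients `d` of a separating functional are nonpositive, since the
  -- orthant is unbounded downwards; normalised, `-d` is a mixed strategy contradicting `h`.
  obtain ⟨f, u, u', hfu, huu, hfv⟩ :=
    geometric_hahn_banach_compact_closed hconv hcomp hQ isClosed_Iic hdisj
  set d : A → ℝ := fun v => f (Pi.single v 1) with hd
  have hf : ∀ y : A → ℝ, f y = ∑ v, y v * d v := by
    intro y
    conv_lhs => rw [← Finset.univ_sum_single y]
    rw [map_sum]
    refine Finset.sum_congr rfl fun v _ => ?_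
    have : Pi.single v (y v) = y v • (Pi.single v (1 : ℝ) : A → ℝ) := by
      rw [← Pi.single_smul]; simp
    rw [this, map_smul, smul_eq_mul]
  have hcc : u' < ∑ v, c * d v := by
    have := hfv (fun _ => c) (Set.mem_Iic.2 le_rfl)
    rwa [hf] at this
  have hd0 : ∀ v, d v ≤ 0 := by
    intro v
    by_contra hv
    push Not at hv
    have hcp : 0 < (∑ v, c * d v) - u' := by linarith
    set t := ((∑ v, c * d v) - u') / d v with ht
    have ht0 : 0 ≤ t := by positivity
    have := hfv ((fun _ => c) - t • Pi.single v 1) (by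
      intro x
      by_cases hx : x = v
      · subst hx; simpa using ht0
      · simp [hx])
    rw [map_sub, map_smul, hf] at this
    change _ < _ - t * d v at this
    rw [ht, div_mul_cancel₀ _ hv.ne'] at this
    linarith
  set D := ∑ v, -d v with hD
  have hDnn : 0 ≤ D := Finset.sum_nonneg fun v _ => by linarith [hd0 v]
  have hDpos : 0 < D := by
    rcases hDnn.lt_or_eq with h0 | h0
    · exact h0
    · exfalso
      have hz : ∀ v, d v = 0 := fun v => by
        have := (Finset.sum_eq_zero_iff_of_nonneg
          (fun v _ => by linarith [hd0 v] : ∀ v ∈ Finset.univ, 0 ≤ -d v)).1 h0.symm v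
            (Finset.mem_univ v)
        linarith
      have h1 := hfu _ ⟨_, single_mem_stdSimplex ℝ (Classical.arbitrary B), rfl⟩
      rw [hf] at h1
      simp only [hz, mul_zero, Finset.sum_const_zero] at h1 hcc
      linarith
  obtain ⟨b, hb⟩ := h (fun v => -d v / D) ⟨fun v => div_nonneg (by linarith [hd0 v]) hDnn, by
    rw [← Finset.sum_div, div_self hDpos.ne']⟩
  have h1 := hfu _ ⟨_, single_mem_stdSimplex ℝ b, rfl⟩
  rw [hf] at h1
  have h2 : ∀ v, T (Pi.single b 1) v = a v b := fun v => by
    change ∑ b', (Pi.single b 1 : B → ℝ) b' * a v b' = a v b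
    simp [Pi.single_apply]
  simp only [h2] at h1
  have h3 : ∑ v, -d v / D * a v b = -(∑ v, a v b * d v) / D := by
    rw [neg_div, Finset.sum_div, ← Finset.sum_neg_distrib]
    exact Finset.sum_congr rfl fun v _ => by ring
  rw [h3, div_le_iff₀ hDpos] at hb
  have h4 : ∑ v, c * d v = -(c * D) := by
    rw [hD, Finset.mul_sum, ← Finset.sum_neg_distrib]
    exact Finset.sum_congr rfl fun v _ => by ring
  linarith

/-! ### Weighted triangle-free graphs -/

section Weighted

variable {V : Type*} [Fintype V]

theorem mass_linear_comb (a b : ℝ) (p q : V → ℝ) (A : Set V) :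
    mass (fun x => a * p x + b * q x) A = a * mass p A + b * mass q A := by
  simp only [mass_eq_sum_mul, Finset.mul_sum, ← Finset.sum_add_distrib]
  exact Finset.sum_congr rfl fun x _ => by ring

theorem mass_sum_type {β : Type*} [Fintype β] (p : V ⊕ β → ℝ) (A : Set (V ⊕ β)) :
    mass p A = mass (p ∘ Sum.inl) (Sum.inl ⁻¹' A) + mass (p ∘ Sum.inr) (Sum.inr ⁻¹' A) := by
  simp only [mass_eq_sum_mul, Fintype.sum_sum_type]
  rfl

/-- The bilinear form of the adjacency matrix. -/
noncomputable def adjForm (H : SimpleGraph V) (w w' : V → ℝ) : ℝ :=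
  ∑ v, w v * mass w' (H.neighborSet v)

theorem adjForm_comm (H : SimpleGraph V) (w w' : V → ℝ) : adjForm H w w' = adjForm H w' w := by
  rw [adjForm, sum_mul_mass_comm]
  refine Finset.sum_congr rfl fun y _ => ?_
  congr 2
  ext x
  simp [H.adj_comm]

theorem adjForm_linear_comb_right (H : SimpleGraph V) (a b : ℝ) (u w w' : V → ℝ) :
    adjForm H u (fun x => a * w x + b * w' x) = a * adjForm H u w + b * adjForm H u w' := by
  simp only [adjForm, mass_linear_comb, Finset.mul_sum, ← Finset.sum_add_distrib]
  exact Finset.sum_congr rfl fun x _ => by ring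

theorem adjForm_linear_comb (H : SimpleGraph V) (a b : ℝ) (w w' : V → ℝ) :
    adjForm H (fun x => a * w x + b * w' x) (fun x => a * w x + b * w' x) =
      a ^ 2 * adjForm H w w + 2 * (a * b) * adjForm H w' w + b ^ 2 * adjForm H w' w' := by
  have h : ∀ u, adjForm H (fun x => a * w x + b * w' x) u =
      a * adjForm H u w + b * adjForm H u w' := fun u => by
    rw [adjForm_comm, adjForm_linear_comb_right]
  rw [adjForm_linear_comb_right, h, h, adjForm_comm H w w']
  ring

/-- `H` is a triangle-free graph with a probability weight `w` on its vertices for which the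
greatest weight of an independent set is `s`. -/
structure IsWeighted (H : SimpleGraph V) (w : V → ℝ) (s : ℝ) : Prop where
  cliqueFree : H.CliqueFree 3
  nonneg : ∀ v, 0 ≤ w v
  sum_eq : ∑ v, w v = 1
  le : ∀ J : Set V, H.IsIndepSet J → mass w J ≤ s
  attained : ∃ J : Set V, H.IsIndepSet J ∧ mass w J = s

theorem exists_isWeighted {H : SimpleGraph V} (hH : H.CliqueFree 3) {w : V → ℝ}
    (hw : ∀ v, 0 ≤ w v) (hs : ∑ v, w v = 1) : ∃ s, IsWeighted H w s := by
  obtain ⟨J, hJ, hmax⟩ := Set.exists_max_image {J : Set V | H.IsIndepSet J} (mass w)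
    (Set.toFinite _) ⟨∅, by simp⟩
  exact ⟨mass w J, hH, hw, hs, hmax, J, hJ, rfl⟩

theorem IsWeighted.adjForm_le {H : SimpleGraph V} {w : V → ℝ} {s : ℝ} (h : IsWeighted H w s) :
    adjForm H w w ≤ s := by
  calc adjForm H w w ≤ ∑ v, w v * s :=
        Finset.sum_le_sum fun v _ =>
          mul_le_mul_of_nonneg_left (h.le _ (SimpleGraph.isIndepSet_neighborSet_of_triangleFree H h.cliqueFree v)) (h.nonneg v)
    _ = s := by rw [← Finset.sum_mul, h.sum_eq, one_mul]

theorem IsWeighted.le_one {H : SimpleGraph V} {w : V → ℝ} {s : ℝ} (h : IsWeighted H w s) :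
    s ≤ 1 := by
  obtain ⟨J, -, rfl⟩ := h.attained
  exact h.sum_eq ▸ mass_le_univ h.nonneg J

theorem adjForm_nonneg {H : SimpleGraph V} {w w' : V → ℝ} (hw : ∀ v, 0 ≤ w v)
    (hw' : ∀ v, 0 ≤ w' v) : 0 ≤ adjForm H w w' :=
  Finset.sum_nonneg fun v _ => mul_nonneg (hw v) (mass_nonneg hw' _)

theorem adjForm_le_one {H : SimpleGraph V} {w w' : V → ℝ} (hw : ∀ v, 0 ≤ w v)
    (hw' : ∀ v, 0 ≤ w' v) (h : ∑ v, w v = 1) (h' : ∑ v, w' v = 1) : adjForm H w w' ≤ 1 := by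
  calc adjForm H w w' ≤ ∑ v, w v * 1 :=
        Finset.sum_le_sum fun v _ =>
          mul_le_mul_of_nonneg_left (h' ▸ mass_le_univ hw' _) (hw v)
    _ = 1 := by rw [← Finset.sum_mul, h, one_mul]

end Weighted

/-- The conjectured upper bound for twice the edge density, as a function of the independence
ratio. -/
noncomputable def density (s : ℝ) : ℝ := 12 - 64 * s + 88 * s ^ 2

/-- The possible differences between the edge density of a weighted triangle-free graph and the
conjectured upper bound. -/
def excessSet : Set ℝ :=
  {x | ∃ (V : Type) (_ : Fintype V) (H : SimpleGraph V) (w : V → ℝ) (s : ℝ),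
    IsWeighted H w s ∧ 4 / 11 ≤ s ∧ s ≤ 3 / 8 ∧ x = adjForm H w w - density s}

theorem bddAbove_excessSet : BddAbove excessSet := by
  refine ⟨1, ?_⟩
  rintro x ⟨V, _, H, w, s, h, h1, h2, rfl⟩
  have := adjForm_le_one (H := H) h.nonneg h.nonneg h.sum_eq h.sum_eq
  rw [density]
  nlinarith

/-! ### Adding a new vertex for every independent set -/

section ConeGraph

variable {V : Type*} (H : SimpleGraph V)

/-- The graph obtained from `H` by adding, for every independent set `J`, a new vertex whose
neighbourhood is `J`. -/
def coneGraph : SimpleGraph (V ⊕ Set V) where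
  Adj
    | .inl u, .inl v => H.Adj u v
    | .inl u, .inr J => u ∈ J ∧ H.IsIndepSet J
    | .inr J, .inl u => u ∈ J ∧ H.IsIndepSet J
    | .inr _, .inr _ => False
  symm := ⟨by
    rintro (u | J) (v | K) h
    · exact h.symm
    · exact h
    · exact h
    · exact h⟩
  loopless := ⟨by
    rintro (u | J) h
    · exact H.loopless.irrefl u h
    · exact h⟩

variable {H}

@[simp] theorem coneGraph_inl_inl {u v : V} : (coneGraph H).Adj (.inl u) (.inl v) ↔ H.Adj u v :=
  Iff.rfl

@[simp] theorem coneGraph_inl_inr {u : V} {J : Set V} :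
    (coneGraph H).Adj (.inl u) (.inr J) ↔ u ∈ J ∧ H.IsIndepSet J := Iff.rfl

@[simp] theorem coneGraph_inr_inl {u : V} {J : Set V} :
    (coneGraph H).Adj (.inr J) (.inl u) ↔ u ∈ J ∧ H.IsIndepSet J := Iff.rfl

@[simp] theorem coneGraph_inr_inr {J K : Set V} : ¬ (coneGraph H).Adj (.inr J) (.inr K) :=
  fun h => h

theorem cliqueFree_three_iff {W : Type*} {G : SimpleGraph W} :
    G.CliqueFree 3 ↔ ∀ a b c, G.Adj a b → G.Adj a c → ¬ G.Adj b c := by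
  classical
  constructor
  · intro h a b c hab hac hbc
    exact h {a, b, c} (SimpleGraph.is3Clique_triple_iff.2 ⟨hab, hac, hbc⟩)
  · intro h t ht
    obtain ⟨a, b, c, hab, hac, hbc, -⟩ := SimpleGraph.is3Clique_iff.1 ht
    exact h a b c hab hac hbc

/-- New vertices are pairwise non-adjacent, so a triangle would contain an edge of `H` inside one of
the independent sets `J`. -/
theorem coneGraph_cliqueFree (hH : H.CliqueFree 3) : (coneGraph H).CliqueFree 3 := by
  have key : ∀ {J : Set V} {u v : V}, u ∈ J → v ∈ J → H.IsIndepSet J → ¬ H.Adj u v :=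
    fun hu hv hJ huv => hJ hu hv huv.ne huv
  rw [cliqueFree_three_iff] at hH ⊢
  rintro (a | a) (b | b) (c | c) hab hac hbc
  · exact hH a b c hab hac hbc
  · exact key hac.1 hbc.1 hac.2 hab
  · exact key hab.1 hbc.1 hbc.2 hac
  · exact hbc
  · exact key hab.1 hac.1 hab.2 hbc
  · exact hac
  · exact hab
  · exact hab

theorem isIndepSet_preimage_inl {I : Set (V ⊕ Set V)} (hI : (coneGraph H).IsIndepSet I) :
    H.IsIndepSet (Sum.inl ⁻¹' I) :=
  fun _ hu _ hv huv => hI hu hv (fun h => huv (Sum.inl_injective h))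

theorem isIndepSet_image_inl {I : Set V} (hI : H.IsIndepSet I) :
    (coneGraph H).IsIndepSet (Sum.inl '' I) := by
  rintro _ ⟨u, hu, rfl⟩ _ ⟨v, hv, rfl⟩ huv
  exact hI hu hv (fun h => huv (h ▸ rfl))

end ConeGraph

/-! ### Duality: from a near-optimal counterexample to a distribution on independent sets -/

/-- Dual data certifying that a weighted graph is an almost optimal counterexample: a distribution
`p` on almost maximum independent sets `S I` such that the vertices and the sets `S K` behave as in
a regular structure of density `κ`, up to a defect `φ` on vertices and an error `η`. -/
structure IsDual {V Ω : Type} [Fintype V] [Fintype Ω] (H : SimpleGraph V) (w : V → ℝ)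
    (S : Ω → Set V) (p : Ω → ℝ) (φ : V → ℝ) (s κ m η : ℝ) : Prop where
  w_nonneg : ∀ v, 0 ≤ w v
  w_sum : ∑ v, w v = 1
  p_nonneg : ∀ I, 0 ≤ p I
  p_sum : ∑ I, p I ≤ 1
  defect_nonneg : ∀ v, 0 ≤ φ v
  indep : ∀ I, H.IsIndepSet (S I)
  indep_le : ∀ J, H.IsIndepSet J → mass w J ≤ s
  tight : ∀ I, s - η ≤ mass w (S I)
  marginal : ∀ v, κ - φ v - η ≤ mass p {I | v ∈ S I}
  defect_sum : ∑ v, w v * φ v ≤ κ - s + η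
  degree : ∀ K, κ - η ≤ mass p {I | Disjoint (S K) (S I)}
  lower : 4 / 11 + m ≤ κ
  upper : κ ≤ 3 / 8 - m
  s_lower : 4 / 11 ≤ s
  s_upper : s ≤ κ + η

/-- Perturbing an almost extremal weighted graph towards another weight on the cone graph. -/
theorem exists_tight_indepSet {V : Type} [Fintype V] {H : SimpleGraph V} {w : V → ℝ}
    {s e θ h : ℝ} (hw : IsWeighted H w s) (hs1 : 4 / 11 + e ≤ s) (hs2 : s ≤ 3 / 8 - e)
    (hsup : ∀ x ∈ excessSet, x ≤ adjForm H w w - density s + θ) (h0 : 0 < h) (he : h ≤ e)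
    {w' : V ⊕ Set V → ℝ} (hw' : w' ∈ stdSimplex ℝ (V ⊕ Set V)) :
    ∃ I : Set (V ⊕ Set V), (coneGraph H).IsIndepSet I ∧
      adjForm (coneGraph H) w' (Sum.elim w 0) - 8 * (11 * s - 4) * mass w' I ≤
        adjForm H w w - 8 * (11 * s - 4) * s + (θ / (2 * h) + 45 * h) := by
  have hfree := coneGraph_cliqueFree hw.cliqueFree
  have hw0 : ∀ v, 0 ≤ (Sum.elim w 0 : V ⊕ Set V → ℝ) v := by
    rintro (v | J)
    · exact hw.nonneg v
    · exact le_rfl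
  have hw1 : ∑ v, (Sum.elim w 0 : V ⊕ Set V → ℝ) v = 1 := by
    simp [Fintype.sum_sum_type, hw.sum_eq]
  have hmass : ∀ I : Set (V ⊕ Set V), mass (Sum.elim w 0) I = mass w (Sum.inl ⁻¹' I) := by
    intro I
    rw [mass_sum_type]
    have : mass ((Sum.elim w 0 : V ⊕ Set V → ℝ) ∘ Sum.inr) (Sum.inr ⁻¹' I) = 0 := by
      simp [mass_eq_sum_mul]
    rw [this, add_zero]
    rfl
  have hform : adjForm (coneGraph H) (Sum.elim w 0) (Sum.elim w 0) = adjForm H w w := by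
    simp only [adjForm, Fintype.sum_sum_type, hmass]
    simp
    rfl
  obtain ⟨α', hα'⟩ := exists_isWeighted hfree hw'.1 hw'.2
  have hh1 : h < 1 := by linarith
  have hwh0 : ∀ v, 0 ≤ (1 - h) * (Sum.elim w 0 : V ⊕ Set V → ℝ) v + h * w' v := fun v =>
    add_nonneg (mul_nonneg (by linarith) (hw0 v)) (mul_nonneg h0.le (hw'.1 v))
  have hwh1 : ∑ v, ((1 - h) * (Sum.elim w 0 : V ⊕ Set V → ℝ) v + h * w' v) = 1 := by
    rw [Finset.sum_add_distrib, ← Finset.mul_sum, ← Finset.mul_sum, hw1, hw'.2]; ring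
  obtain ⟨α, hα⟩ := exists_isWeighted hfree hwh0 hwh1
  obtain ⟨I, hI, hIα⟩ := hα'.attained
  refine ⟨I, hI, ?_⟩
  have hα'1 : α' ≤ 1 := hα'.le_one
  have hup : α ≤ (1 - h) * s + h * α' := by
    obtain ⟨J, hJ, rfl⟩ := hα.attained
    rw [mass_linear_comb, hmass]
    have h1 := hw.le _ (isIndepSet_preimage_inl hJ)
    have h2 := hα'.le _ hJ
    have := mul_le_mul_of_nonneg_left h1 (by linarith : 0 ≤ 1 - h)
    have := mul_le_mul_of_nonneg_left h2 h0.le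
    linarith
  have hlo : (1 - h) * s ≤ α := by
    obtain ⟨J, hJ, hJs⟩ := hw.attained
    have h1 := hα.le _ (isIndepSet_image_inl hJ)
    rw [mass_linear_comb, hmass, Set.preimage_image_eq _ Sum.inl_injective, hJs] at h1
    have := mul_nonneg h0.le (mass_nonneg hw'.1 (Sum.inl '' J))
    linarith
  have hα'0 : 0 ≤ α' := hIα ▸ mass_nonneg hw'.1 I
  have hlo' : 4 / 11 ≤ α := by nlinarith
  have hup' : α ≤ 3 / 8 := by nlinarith
  have hex := hsup _ ⟨V ⊕ Set V, inferInstance, coneGraph H, _, α, hα, hlo', hup', rfl⟩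
  rw [adjForm_linear_comb, hform] at hex
  set X := adjForm (coneGraph H) w' (Sum.elim w 0) with hX
  set E := adjForm H w w with hE
  have hX0 : 0 ≤ X := adjForm_nonneg hw'.1 hw0
  have hX1 : X ≤ 1 := adjForm_le_one hw'.1 hw0 hw'.2 hw1
  have hE0 : 0 ≤ E := adjForm_nonneg hw.nonneg hw.nonneg
  have hY0 : 0 ≤ adjForm (coneGraph H) w' w' := adjForm_nonneg hw'.1 hw'.1
  have hY1 : 0 ≤ h ^ 2 * adjForm (coneGraph H) w' w' := by positivity
  -- `density` is increasing from `4/11` on, its minimum point.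
  have hdens : density α ≤ density ((1 - h) * s + h * α') := by
    have : 0 ≤ ((1 - h) * s + h * α' - α) * (((1 - h) * s + h * α') + α - 8 / 11) :=
      mul_nonneg (by linarith) (by linarith)
    simp only [density]
    nlinarith
  have hdens2 : density ((1 - h) * s + h * α') - density s ≤
      16 * (11 * s - 4) * h * (α' - s) + 88 * h ^ 2 := by
    have h1 : (α' - s) ^ 2 ≤ 1 := by
      have : -1 ≤ α' - s := by linarith
      have : α' - s ≤ 1 := by linarith
      nlinarith
    have h2 : h ^ 2 * (α' - s) ^ 2 ≤ h ^ 2 := by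
      have : 0 ≤ h ^ 2 := by positivity
      nlinarith
    simp only [density]
    nlinarith
  -- The first-order terms are kept; the slope of `density` at `s` is `16 * (11 * s - 4)`. The
  -- second-order terms cost `88 * h ^ 2` from `density` and `2 * h ^ 2` from `X`, whence `45 * h`
  -- after division by `2 * h`.
  have key : 2 * h * X ≤ 2 * h * E + θ + 16 * (11 * s - 4) * h * (α' - s) + 90 * h ^ 2 := by
    have h1 : h ^ 2 * X ≤ h ^ 2 := by
      have : 0 ≤ h ^ 2 := by positivity
      nlinarith
    have h2 : 0 ≤ h ^ 2 * E := by positivity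
    nlinarith
  rw [hIα]
  have h3 : θ = 2 * h * (θ / (2 * h)) := by field_simp
  have : 2 * h * (X - 8 * (11 * s - 4) * α') ≤
      2 * h * (E - 8 * (11 * s - 4) * s + (θ / (2 * h) + 45 * h)) := by
    nlinarith
  exact le_of_mul_le_mul_left this (by linarith)

theorem mass_subtype {α : Type*} [Fintype α] (p : α → ℝ) (G A : Set α) [Fintype G] :
    mass (fun x : G => p x) {x | (x : α) ∈ A} = mass p (A ∩ G) := by
  classical
  have h : ∀ x : G, ({x : G | (x : α) ∈ A} : Set G).indicator (fun x => p x) x =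
      A.indicator p (x : α) := fun x => by
    by_cases hx : (x : α) ∈ A <;> simp [hx]
  simp only [mass, h]
  rw [Finset.sum_set_coe, ← Finset.sum_subset (Finset.subset_univ G.toFinset)]
  · refine Finset.sum_congr rfl fun x hx => ?_
    have : x ∈ G := by simpa using hx
    by_cases h1 : x ∈ A <;> simp [h1, this]
  · intro x _ hx
    have : x ∉ G := by simpa using hx
    simp [this]

-- The minimax lemma is applied to the game of cone-graph vertices against independent sets of the
-- cone graph. Vertices of `H` give the marginals, cone vertices give the degrees, and averaging the
-- marginals over `w` shows that the random set is almost maximum.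
set_option maxHeartbeats 1000000 in
theorem exists_isDual {ε : ℝ} (hε : 0 < ε) (hmem : ε ∈ excessSet) :
    ∃ m > 0, ∀ η > 0, ∃ (V Ω : Type) (_ : Fintype V) (_ : Fintype Ω) (H : SimpleGraph V)
      (w : V → ℝ) (S : Ω → Set V) (p : Ω → ℝ) (φ : V → ℝ) (s κ : ℝ),
      IsDual H w S p φ s κ m η := by
  refine ⟨ε / 4, by positivity, fun η₀ hη₀ => ?_⟩
  set e := ε / 2 with he
  have he0 : 0 < e := by positivity
  -- The errors are chosen in the order `η`, `θ₁` (value of the game), `h` (step length), `θ`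
  -- (distance from the supremum), so that `θ / (2 * h) + 45 * h ≤ θ₁`.
  obtain ⟨η, hη, hηη, hη1⟩ : ∃ η, 0 < η ∧ η ≤ η₀ ∧ η ≤ 1 :=
    ⟨min η₀ 1, by positivity, min_le_left _ _, min_le_right _ _⟩
  obtain ⟨θ₁, hθ₁, hθe, hθη⟩ : ∃ θ, 0 < θ ∧ θ ≤ 44 * e * e ∧ θ ≤ 44 * e * (e * η * η / 2) :=
    ⟨min (44 * e * e) (44 * e * (e * η * η / 2)), by positivity, min_le_left _ _, min_le_right _ _⟩
  obtain ⟨h, hh, hhe, hhθ⟩ : ∃ h, 0 < h ∧ h ≤ e ∧ 45 * h ≤ θ₁ / 2 :=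
    ⟨min e (θ₁ / 90), by positivity, min_le_left _ _, by linarith [min_le_right e (θ₁ / 90)]⟩
  obtain ⟨θ, hθ, hθe', hθh⟩ : ∃ θ, 0 < θ ∧ θ ≤ e ∧ θ / (2 * h) ≤ θ₁ / 2 := by
    refine ⟨min e (h * θ₁), by positivity, min_le_left _ _, ?_⟩
    rw [div_le_iff₀ (by positivity)]
    linarith [min_le_right e (h * θ₁)]
  have hsup : ε ≤ sSup excessSet := le_csSup bddAbove_excessSet hmem
  obtain ⟨x, ⟨V, _, H, w, s, hw, hs1, hs2, rfl⟩, hx⟩ :=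
    exists_lt_of_lt_csSup ⟨ε, hmem⟩ (show sSup excessSet - θ < sSup excessSet by linarith)
  have hnear : ∀ x ∈ excessSet, x ≤ adjForm H w w - density s + θ := fun x hx' =>
    (le_csSup bddAbove_excessSet hx').trans (by linarith)
  have hex : e ≤ adjForm H w w - density s := by linarith
  set E := adjForm H w w with hE
  have hEs : E ≤ s := hw.adjForm_le
  set τ := 11 * s - 4 with hτ
  -- Since `E ≤ s`, the excess is at most this product, which vanishes at `4/11` and `3/8`; an
  -- excess of at least `e` keeps `s` away from both ends.
  have hfac : s - density s = (3 - 8 * s) * τ := by rw [density, hτ]; ring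
  have hρτ : e ≤ (3 - 8 * s) * τ := by rw [← hfac]; linarith
  have hτ1 : 11 * e ≤ τ := by nlinarith
  have hρ1 : 8 * e ≤ 3 - 8 * s := by nlinarith
  have hτ0 : 0 < τ := by linarith
  have hτu : τ ≤ 1 / 8 := by linarith
  have hgame := fun w' hw' => exists_tight_indepSet hw (e := e) (by linarith) (by linarith) hnear
    hh hhe (w' := w') hw'
  set c := E - 8 * τ * s + θ₁ with hc
  have : Nonempty V := by
    by_contra hV
    rw [not_nonempty_iff] at hV
    have := hw.sum_eq
    simp at this
  have hΩ : Fintype {I : Set (V ⊕ Set V) // (coneGraph H).IsIndepSet I} := Fintype.ofFinite _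
  set d : V ⊕ Set V → ℝ := fun v => mass (Sum.elim w 0) ((coneGraph H).neighborSet v) with hd
  obtain ⟨p, hp, hpv⟩ := exists_mixed_strategy
    (fun (v : V ⊕ Set V) (I : {I : Set (V ⊕ Set V) // (coneGraph H).IsIndepSet I}) =>
      d v - 8 * τ * (I : Set (V ⊕ Set V)).indicator 1 v) c (by
    intro w' hw'
    obtain ⟨I, hI, hle⟩ := hgame w' hw'
    refine ⟨⟨I, hI⟩, ?_⟩
    have : ∑ v, w' v * (d v - 8 * τ * I.indicator 1 v) =
        adjForm (coneGraph H) w' (Sum.elim w 0) - 8 * τ * mass w' I := by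
      rw [mass_eq_sum_mul, adjForm, Finset.mul_sum, ← Finset.sum_sub_distrib]
      exact Finset.sum_congr rfl fun v _ => by ring
    rw [this]
    linarith)
  have hp0 : ∀ I, 0 ≤ p I := hp.1
  have hp1 : ∑ I, p I = 1 := hp.2
  have hpv' : ∀ v, d v - 8 * τ * mass p {I | v ∈ I.1} ≤ c := by
    intro v
    refine le_trans (le_of_eq ?_) (hpv v)
    simp only [mul_sub, Finset.sum_sub_distrib]
    rw [← Finset.sum_mul, hp1, one_mul, mass_eq_sum_mul, Finset.mul_sum]
    congr 1
    refine Finset.sum_congr rfl fun I _ => ?_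
    by_cases hI : v ∈ I.1
    · simp [hI]; ring
    · simp [hI]
  have hd_inl : ∀ v, d (.inl v) = mass w (H.neighborSet v) := by
    intro v
    rw [hd]
    simp only
    rw [mass_sum_type]
    have : mass ((Sum.elim w 0 : V ⊕ Set V → ℝ) ∘ Sum.inr)
        (Sum.inr ⁻¹' (coneGraph H).neighborSet (.inl v)) = 0 := by
      simp [mass_eq_sum_mul]
    rw [this, add_zero]
    rfl
  have hd_inr : ∀ J, H.IsIndepSet J → d (.inr J) = mass w J := by
    intro J hJ
    rw [hd]
    simp only
    rw [mass_sum_type]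
    have : mass ((Sum.elim w 0 : V ⊕ Set V → ℝ) ∘ Sum.inr)
        (Sum.inr ⁻¹' (coneGraph H).neighborSet (.inr J)) = 0 := by
      simp [mass_eq_sum_mul]
    rw [this, add_zero]
    congr 1
    ext v
    simp [hJ]
  -- `κ` is the bound that the game yields for a cone vertex `J` of mass `s`; up to the error from
  -- `θ₁` it is `s + (s - E) / (8 * τ)`.
  set κ := (s - c) / (8 * τ) with hκ
  have hκτ : 8 * τ * κ = s - c := by rw [hκ]; field_simp
  set φ : V → ℝ := fun v => (s - mass w (H.neighborSet v)) / (8 * τ) with hφ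
  have hφτ : ∀ v, 8 * τ * φ v = s - mass w (H.neighborSet v) := fun v => by
    rw [hφ]; field_simp
  have h8τ : 0 < 8 * τ := by positivity
  have hφ0 : ∀ v, 0 ≤ φ v := fun v =>
    div_nonneg (sub_nonneg.2 (hw.le _
      (SimpleGraph.isIndepSet_neighborSet_of_triangleFree H hw.cliqueFree v))) h8τ.le
  have hmarg : ∀ v : V, κ - φ v ≤ mass p {I | Sum.inl v ∈ I.1} := by
    intro v
    have h1 := hpv' (.inl v)
    rw [hd_inl] at h1
    refine le_of_mul_le_mul_left ?_ h8τ
    rw [mul_sub, hκτ, hφτ]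
    linarith
  have hdisj : ∀ J, H.IsIndepSet J →
      8 * τ * κ - (s - mass w J) ≤ 8 * τ * mass p {I | Disjoint J (Sum.inl ⁻¹' I.1)} := by
    intro J hJ
    have h1 := hpv' (.inr J)
    rw [hd_inr J hJ] at h1
    -- An independent set containing the cone vertex of `J` contains no element of `J`.
    have h2 : mass p {I | Sum.inr J ∈ I.1} ≤ mass p {I | Disjoint J (Sum.inl ⁻¹' I.1)} := by
      refine mass_mono hp0 fun I hI => Set.disjoint_left.2 fun v hvJ hvI => ?_
      exact I.2 hI hvI (by simp) (coneGraph_inr_inl.2 ⟨hvJ, hJ⟩)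
    have := mul_le_mul_of_nonneg_left h2 h8τ.le
    rw [hκτ]
    linarith
  have hφsum : 8 * τ * ∑ v, w v * φ v = s - E := by
    have h1 : ∀ v, 8 * τ * (w v * φ v) = w v * s - w v * mass w (H.neighborSet v) := fun v => by
      rw [mul_left_comm, hφτ]; ring
    rw [Finset.mul_sum, Finset.sum_congr rfl fun v _ => h1 v, Finset.sum_sub_distrib,
      ← Finset.sum_mul, hw.sum_eq, one_mul]
    rfl
  have htight : 8 * τ * ∑ I, p I * (s - mass w (Sum.inl ⁻¹' I.1)) ≤ θ₁ := by
    have h1 : ∑ I, p I * (s - mass w (Sum.inl ⁻¹' I.1)) =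
        s - ∑ v, w v * mass p {I | Sum.inl v ∈ I.1} := by
      have := sum_mul_mass_comm p w (fun I => Sum.inl ⁻¹' I.1)
      simp only [mul_sub, Finset.sum_sub_distrib]
      rw [← Finset.sum_mul, hp1, one_mul, this]
      rfl
    have h2 : ∑ v, w v * (κ - φ v) ≤ ∑ v, w v * mass p {I | Sum.inl v ∈ I.1} :=
      Finset.sum_le_sum fun v _ => mul_le_mul_of_nonneg_left (hmarg v) (hw.nonneg v)
    have h3 : ∑ v, w v * (κ - φ v) = κ - ∑ v, w v * φ v := by
      simp only [mul_sub, Finset.sum_sub_distrib]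
      rw [← Finset.sum_mul, hw.sum_eq, one_mul]
    rw [h3] at h2
    have := mul_le_mul_of_nonneg_left h2 h8τ.le
    rw [h1, mul_sub]
    rw [mul_sub, hφsum, hκτ] at this
    linarith
  -- By Markov's inequality the sets with slack above `e * η` have total probability at most `η /
  -- 2`; they are discarded without renormalising `p`.
  set G : Set {I : Set (V ⊕ Set V) // (coneGraph H).IsIndepSet I} :=
    {I | s - e * η ≤ mass w (Sum.inl ⁻¹' I.1)} with hG
  have hslack : ∀ I : {I : Set (V ⊕ Set V) // (coneGraph H).IsIndepSet I},
      0 ≤ s - mass w (Sum.inl ⁻¹' I.1) := fun I =>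
    sub_nonneg.2 (hw.le _ (isIndepSet_preimage_inl I.2))
  have hbad : mass p Gᶜ ≤ η / 2 := by
    have h1 : e * η * mass p Gᶜ ≤ ∑ I, p I * (s - mass w (Sum.inl ⁻¹' I.1)) := by
      rw [mass_eq_sum_mul, Finset.mul_sum]
      refine Finset.sum_le_sum fun I _ => ?_
      by_cases hI : I ∈ G
      · simpa [hI] using mul_nonneg (hp0 I) (hslack I)
      · have h2 : mass w (Sum.inl ⁻¹' I.1) < s - e * η := not_le.1 hI
        simp only [Set.indicator_of_mem (Set.mem_compl hI), Pi.one_apply]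
        rw [mul_one, mul_comm]
        exact mul_le_mul_of_nonneg_left (by linarith) (hp0 I)
    have h2 : 8 * τ * (e * η * mass p Gᶜ) ≤ 8 * τ * (e * η * (η / 2)) := by
      refine (mul_le_mul_of_nonneg_left h1 h8τ.le).trans (htight.trans (hθη.trans ?_))
      have : 0 ≤ e * η * η / 2 := by positivity
      nlinarith
    exact le_of_mul_le_mul_left (le_of_mul_le_mul_left h2 h8τ) (by positivity)
  have hrestrict : ∀ A, mass p A - η / 2 ≤ mass p (A ∩ G) := by
    intro A
    have h1 := mass_inter_add_diff p A G
    have h2 : mass p (A \ G) ≤ mass p Gᶜ := mass_mono hp0 fun x hx => hx.2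
    linarith
  have : Fintype G := Fintype.ofFinite _
  have hθη8 : θ₁ ≤ 8 * τ * η := by
    have h1 : e * η * η / 2 ≤ η * 2 := by
      have : e ≤ 4 := by linarith
      have h3 : e * η ≤ 4 * 1 := mul_le_mul this hη1 hη.le (by norm_num)
      nlinarith
    have h2 : 44 * e * (e * η * η / 2) ≤ 44 * e * (η * 2) :=
      mul_le_mul_of_nonneg_left h1 (by positivity)
    nlinarith
  have hFs : 8 * τ * κ - 8 * τ * s = s - E - θ₁ := by rw [hκτ]; ring
  refine ⟨V, G, inferInstance, inferInstance, H, w, fun I => Sum.inl ⁻¹' I.1.1, fun I => p I, φ,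
    s, κ, hw.nonneg, hw.sum_eq, fun I => hp0 I, ?_, hφ0, fun I => isIndepSet_preimage_inl I.1.2,
    hw.le, ?_, ?_, ?_, ?_, ?_, ?_, hs1, ?_⟩
  · have h1 := mass_subtype p G Set.univ
    have h2 := mass_le_univ hp0 (Set.univ ∩ G)
    rw [hp1] at h2
    simp only [Set.mem_univ, Set.ofPred_true, mass_univ] at h1
    rw [h1]
    exact h2
  · rintro ⟨I, hI⟩
    have hI' : s - e * η ≤ mass w (Sum.inl ⁻¹' I.1) := hI
    have : e * η ≤ η := by
      have : e ≤ 1 := by linarith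
      nlinarith
    simp only
    linarith
  · intro v
    have h1 := mass_subtype p G {I | Sum.inl v ∈ I.1}
    have h2 := hrestrict {I | Sum.inl v ∈ I.1}
    have h3 := hmarg v
    rw [← h1] at h2
    refine le_trans ?_ h2
    linarith
  · refine le_of_mul_le_mul_left ?_ h8τ
    rw [hφsum]
    have : 8 * τ * η ≤ 8 * τ * η₀ := mul_le_mul_of_nonneg_left hηη h8τ.le
    linarith
  · rintro ⟨K, hK⟩
    have hK' : s - e * η ≤ mass w (Sum.inl ⁻¹' K.1) := hK
    have h1 := mass_subtype p G {I | Disjoint (Sum.inl ⁻¹' K.1 : Set V) (Sum.inl ⁻¹' I.1)}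
    have h2 := hrestrict {I | Disjoint (Sum.inl ⁻¹' K.1 : Set V) (Sum.inl ⁻¹' I.1)}
    have h3 := hdisj _ (isIndepSet_preimage_inl K.2)
    rw [← h1] at h2
    refine le_trans ?_ h2
    have h4 : 8 * τ * (κ - η / 2) ≤
        8 * τ * mass p {I | Disjoint (Sum.inl ⁻¹' K.1 : Set V) (Sum.inl ⁻¹' I.1)} := by
      refine le_trans ?_ h3
      nlinarith
    have := le_of_mul_le_mul_left h4 h8τ
    linarith
  · have h1 : 8 * τ * s - 8 * τ * (e / 2) ≤ 8 * τ * κ := by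
      nlinarith
    have h2 : 8 * τ * (s - e / 2) ≤ 8 * τ * κ := by linarith
    have := le_of_mul_le_mul_left h2 h8τ
    linarith
  -- Here the positive excess is used: it gives `κ ≤ 3/8 - e / (8 * τ)`, and `8 * τ ≤ 1`.
  · have h2 : 8 * τ * κ ≤ 8 * τ * (3 / 8 - e) := by
      have : s - E ≤ (3 - 8 * s) * τ - e := by rw [← hfac]; linarith
      nlinarith
    have := le_of_mul_le_mul_left h2 h8τ
    linarith
  · have h1 : 8 * τ * s ≤ 8 * τ * (κ + η₀) := by
      have : 8 * τ * η ≤ 8 * τ * η₀ := mul_le_mul_of_nonneg_left hηη h8τ.le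
      linarith
    exact le_of_mul_le_mul_left h1 h8τ

/-! ### The disjointness graph is a regular system -/

/-- A weighted triangle-free graph, almost regular of density `κ`, in which almost every
non-neighbour of a vertex has many common neighbours with it. -/
structure IsRegularSystem {Ω : Type} [Fintype Ω] (D : SimpleGraph Ω) (p : Ω → ℝ) (κ m ε : ℝ) :
    Prop where
  cliqueFree : D.CliqueFree 3
  p_nonneg : ∀ I, 0 ≤ p I
  p_sum_le : ∑ I, p I ≤ 1
  le_p_sum : 1 - ε ≤ ∑ I, p I
  le_degree : ∀ K, κ - ε ≤ mass p (D.neighborSet K)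
  degree_le : ∀ K, mass p (D.neighborSet K) ≤ κ + ε
  sparse : ∀ K, mass p {I | ¬ D.Adj K I ∧ mass p (D.neighborSet K ∩ D.neighborSet I) ≤ m} ≤ ε
  lower : 4 / 11 + m ≤ κ
  upper : κ ≤ 3 / 8 - m

/-- The graph on an index set in which two indices are adjacent if the corresponding sets are
disjoint. -/
def disjointnessGraph {V Ω : Type} (S : Ω → Set V) : SimpleGraph Ω :=
  SimpleGraph.fromRel fun I J => Disjoint (S I) (S J)

namespace IsDual

variable {V Ω : Type} [Fintype V] [Fintype Ω] {H : SimpleGraph V} {w : V → ℝ}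
  {S : Ω → Set V} {p : Ω → ℝ} {φ : V → ℝ} {s κ m η : ℝ}

theorem adj_iff (h : IsDual H w S p φ s κ m η) (hη : η < 1 / 11) {I J : Ω} :
    (disjointnessGraph S).Adj I J ↔ Disjoint (S I) (S J) := by
  rw [disjointnessGraph, SimpleGraph.fromRel_adj, disjoint_comm (a := S J), or_self]
  refine ⟨fun h => h.2, fun hd => ⟨?_, hd⟩⟩
  rintro rfl
  rw [disjoint_self, Set.bot_eq_empty] at hd
  have h1 := h.tight I
  rw [hd, mass_empty] at h1
  linarith [h.s_lower]

/-- Three pairwise disjoint sets of mass near `s ≥ 4/11` exceed the total mass 1. -/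
theorem disjointnessGraph_cliqueFree (h : IsDual H w S p φ s κ m η) (hη : η < 1 / 33) :
    (disjointnessGraph S).CliqueFree 3 := by
  rw [cliqueFree_three_iff]
  intro a b c hab hac hbc
  rw [h.adj_iff (by linarith)] at hab hac hbc
  have h1 := mass_union_of_disjoint w hab
  have h2 := mass_add_le h.w_nonneg (Set.disjoint_union_left.2 ⟨hac, hbc⟩)
  rw [h.w_sum] at h2
  linarith [h.tight a, h.tight b, h.tight c, h.s_lower]

/-- A random set has mass at most `s`, and by the marginals it spends at least `κ * mass w Cᶜ - (κ -
s)` of it outside `C` on average, up to errors; what remains for `C` is `κ * mass w C`. -/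
theorem sum_mul_mass_inter_le (h : IsDual H w S p φ s κ m η) (hη : 0 ≤ η) (C : Set V) :
    ∑ I, p I * mass w (C ∩ S I) ≤ κ * mass w C + 2 * η := by
  have hsum : ∀ I, mass w (C ∩ S I) ≤ s - mass w (Cᶜ ∩ S I) := fun I => by
    have h1 := mass_inter_add_diff w (S I) C
    have h2 := h.indep_le _ (h.indep I)
    rw [Set.inter_comm C, Set.inter_comm Cᶜ, ← Set.sdiff_eq]
    linarith
  have hs0 : 0 ≤ s := by linarith [h.s_lower]
  have h1 : ∑ I, p I * mass w (C ∩ S I) ≤ s - ∑ I, p I * mass w (Cᶜ ∩ S I) := by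
    calc ∑ I, p I * mass w (C ∩ S I) ≤ ∑ I, p I * (s - mass w (Cᶜ ∩ S I)) :=
          Finset.sum_le_sum fun I _ => mul_le_mul_of_nonneg_left (hsum I) (h.p_nonneg I)
      _ = (∑ I, p I) * s - ∑ I, p I * mass w (Cᶜ ∩ S I) := by
          simp only [mul_sub, Finset.sum_sub_distrib, Finset.sum_mul]
      _ ≤ s - ∑ I, p I * mass w (Cᶜ ∩ S I) := by
          nlinarith [h.p_sum]
  have h2 : κ * mass w Cᶜ - ∑ v, w v * φ v - η ≤ ∑ I, p I * mass w (Cᶜ ∩ S I) := by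
    have h3 : ∑ I, p I * mass w (Cᶜ ∩ S I) = ∑ v, Cᶜ.indicator w v * mass p {I | v ∈ S I} := by
      rw [sum_mul_mass_comm]
      refine Finset.sum_congr rfl fun v _ => ?_
      by_cases hv : v ∈ C <;> simp [hv, mass_empty]
    have h4 : ∀ v, Cᶜ.indicator w v * κ - w v * φ v - w v * η ≤
        Cᶜ.indicator w v * mass p {I | v ∈ S I} := by
      intro v
      have h5 := h.marginal v
      have h6 := mul_nonneg (h.w_nonneg v) (h.defect_nonneg v)
      have h7 := mul_nonneg (h.w_nonneg v) hη
      by_cases hv : v ∈ C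
      · simp [hv]; linarith
      · simp only [Set.mem_compl_iff, hv, not_false_eq_true, Set.indicator_of_mem]
        nlinarith [h.w_nonneg v]
    rw [h3]
    refine le_trans (le_of_eq ?_) (Finset.sum_le_sum fun v _ => h4 v)
    simp only [Finset.sum_sub_distrib, ← Finset.sum_mul, h.w_sum]
    rw [mass]; ring
  have h5 := mass_add_compl w C
  rw [h.w_sum] at h5
  have h6 : κ * mass w C = κ - κ * mass w Cᶜ := by rw [eq_sub_of_add_eq h5]; ring
  linarith [h.defect_sum]

theorem le_p_sum (h : IsDual H w S p φ s κ m η) (hη : 0 ≤ η) : 1 - 6 * η ≤ ∑ I, p I := by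
  have h1 : ∑ v, w v * mass p {I | v ∈ S I} ≤ s * ∑ I, p I := by
    rw [← sum_mul_mass_comm, mul_comm, Finset.sum_mul]
    exact Finset.sum_le_sum fun I _ =>
      mul_le_mul_of_nonneg_left (h.indep_le _ (h.indep I)) (h.p_nonneg I)
  have h2 : ∑ v, w v * (κ - φ v - η) ≤ ∑ v, w v * mass p {I | v ∈ S I} :=
    Finset.sum_le_sum fun v _ => mul_le_mul_of_nonneg_left (h.marginal v) (h.w_nonneg v)
  simp only [mul_sub, Finset.sum_sub_distrib, ← Finset.sum_mul, h.w_sum] at h2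
  have h3 := h.defect_sum
  have h4 := h.s_lower
  nlinarith [h.p_sum]

/-- A family of sets `S I` of large total mass contains a set meeting a given set `C` in at most
its fair share. -/
theorem exists_mass_inter_le (h : IsDual H w S p φ s κ m η) (hη : 0 ≤ η) {N : Set Ω} {c : ℝ}
    (hc : 0 < c) (hN : c ≤ mass p N) (C : Set V) :
    ∃ I ∈ N, c * mass w (C ∩ S I) ≤ κ * mass w C + 2 * η := by
  obtain ⟨I, hI, hmin⟩ := Set.exists_min_image N (fun I => mass w (C ∩ S I)) (Set.toFinite _)
    (nonempty_of_mass_pos (hc.trans_le hN))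
  refine ⟨I, hI, le_trans ?_ (h.sum_mul_mass_inter_le hη C)⟩
  calc c * mass w (C ∩ S I) ≤ mass p N * mass w (C ∩ S I) :=
        mul_le_mul_of_nonneg_right hN (mass_nonneg h.w_nonneg _)
    _ ≤ _ := by
        rw [mass, Finset.sum_mul]
        refine Finset.sum_le_sum fun J _ => ?_
        by_cases hJ : J ∈ N
        · simp only [hJ, Set.indicator_of_mem]
          exact mul_le_mul_of_nonneg_left (hmin J hJ) (h.p_nonneg J)
        · simpa [hJ] using mul_nonneg (h.p_nonneg J) (mass_nonneg h.w_nonneg _)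

/-- Sets from a family of mass larger than `κ` can be chosen such that their intersection is small;
then their union is large. -/
theorem exists_large_union (h : IsDual H w S p φ s κ m η) (hη : 0 ≤ η) {N : Set Ω} {ε : ℝ}
    (hε : 0 < ε) (hN : κ + ε ≤ mass p N) (hκ : 1 / 3 ≤ κ) (k : ℕ) :
    ∃ C U : Set V, C ⊆ U ∧ (∀ u ∈ U, ∃ I ∈ N, u ∈ S I) ∧ H.IsIndepSet C ∧
      (∀ c ∈ C, ∀ u ∈ U, ¬ H.Adj c u) ∧ mass w C ≤ (κ / (κ + ε)) ^ k + 6 * k * η ∧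
      2 * s - (k + 2) * η ≤ mass w C + mass w U := by
  have hκε : 0 < κ + ε := by linarith
  induction k with
  | zero =>
    obtain ⟨I, hI⟩ := nonempty_of_mass_pos (hκε.trans_le hN)
    refine ⟨S I, S I, subset_rfl, fun u hu => ⟨I, hI, hu⟩, h.indep I, fun c hc u hu huc =>
      h.indep I hc hu huc.ne huc, ?_, ?_⟩
    · simpa [h.w_sum] using mass_le_univ h.w_nonneg (S I)
    · push_cast
      linarith [h.tight I]
  | succ k ih =>
    obtain ⟨C, U, hCU, hU, hC, hCU', hCm, hsum⟩ := ih
    obtain ⟨I, hI, hIC⟩ := h.exists_mass_inter_le hη hκε hN C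
    refine ⟨C ∩ S I, U ∪ S I, Set.inter_subset_right.trans Set.subset_union_right, ?_,
      hC.mono Set.inter_subset_left, ?_, ?_, ?_⟩
    · rintro u (hu | hu)
      · exact hU u hu
      · exact ⟨I, hI, hu⟩
    · rintro c ⟨hc, hcI⟩ u (hu | hu) huc
      · exact hCU' c hc u hu huc
      · exact h.indep I hcI hu huc.ne huc
    · have hq : κ / (κ + ε) ≤ 1 := (div_le_one hκε).2 (by linarith)
      have hq0 : 0 ≤ κ / (κ + ε) := by positivity
      have h1 : mass w (C ∩ S I) ≤ κ / (κ + ε) * mass w C + 6 * η := by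
        refine le_of_mul_le_mul_left (hIC.trans ?_) hκε
        have : (κ + ε) * (κ / (κ + ε) * mass w C + 6 * η) =
            κ * mass w C + 6 * (κ + ε) * η := by field_simp
        rw [this]
        nlinarith
      have h2 := mul_le_mul_of_nonneg_left hCm hq0
      have h3 : κ / (κ + ε) * (6 * k * η) ≤ 6 * k * η := by
        have : 0 ≤ 6 * k * η := by positivity
        nlinarith
      rw [pow_succ]
      push_cast
      linarith
    -- Uncrossing: no edge joins `C` to `U`, so this set is independent and has mass at most `s`. By
    -- modularity `mass w C + mass w U` then drops by at most the slack of `S I`.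
    · have hind : H.IsIndepSet (C ∪ S I ∩ U) := by
        rintro x (hx | hx) y (hy | hy) hxy hadj
        · exact hC hx hy hxy hadj
        · exact hCU' x hx y hy.2 hadj
        · exact hCU' y hy x hx.2 hadj.symm
        · exact h.indep I hx.1 hy.1 hxy hadj
      have h1 := h.indep_le _ hind
      have h2 := mass_union_add_inter w C (S I ∩ U)
      have h3 := mass_union_add_inter w U (S I)
      have h4 : C ∩ (S I ∩ U) = C ∩ S I := by
        ext x
        simp only [Set.mem_inter_iff]
        exact ⟨fun hx => ⟨hx.1, hx.2.1⟩, fun hx => ⟨hx.1, hx.2, hCU hx.1⟩⟩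
      rw [h4] at h2
      rw [Set.inter_comm] at h3
      push_cast
      linarith [h.tight I]

/-- If the union of the sets `S I` having few common neighbours with `K` is large, then too many
vertices have a large defect. -/
theorem union_le (h : IsDual H w S p φ s κ m η) (hη : 0 ≤ η) (hm : 0 < m)
    (hηm : 16 * η ≤ m) (K : Ω) {U : Set V}
    (hU : ∀ u ∈ U, ∃ I, u ∈ S I ∧ mass p {J | Disjoint (S K) (S J) ∧ Disjoint (S I) (S J)} ≤ m) :
    mass w U < 2 * s - m := by
  by_contra! hcon
  have hs : s ≤ 3 / 8 := by linarith [h.s_upper, h.upper]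
  have h1 : 3 * s - 1 - η - m ≤ mass w (S K ∩ U) := by
    have h2 := mass_union_add_inter w (S K) U
    have h3 := mass_le_univ h.w_nonneg (S K ∪ U)
    rw [h.w_sum] at h3
    linarith [h.tight K]
  -- A set containing `v` is adjacent neither to `K` nor to `I`, whose neighbourhoods overlap in at
  -- most `m`. So the marginal of `v` is at most about `1 - 2 * κ`, forcing a large defect.
  have h2 : ∀ v ∈ S K ∩ U, 3 * κ - 1 - 3 * η - m ≤ φ v := by
    rintro v ⟨hvK, hvU⟩
    obtain ⟨I, hvI, hI⟩ := hU v hvU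
    have h3 := mass_union_add_inter p {J | Disjoint (S K) (S J)} {J | Disjoint (S I) (S J)}
    have h4 : mass p ({J | Disjoint (S K) (S J)} ∩ {J | Disjoint (S I) (S J)}) ≤ m := hI
    have h5 := mass_add_le h.p_nonneg (A := {J | v ∈ S J})
      (B := {J | Disjoint (S K) (S J)} ∪ {J | Disjoint (S I) (S J)}) (by
        rw [Set.disjoint_left]
        rintro J hJ (hJ' | hJ')
        · exact Set.disjoint_left.1 hJ' hvK hJ
        · exact Set.disjoint_left.1 hJ' hvI hJ)
    linarith [h.degree K, h.degree I, h.marginal v, h.p_sum]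
  have h3 : (3 * κ - 1 - 3 * η - m) * mass w (S K ∩ U) ≤ ∑ v, w v * φ v := by
    rw [mass, Finset.mul_sum]
    refine Finset.sum_le_sum fun v _ => ?_
    by_cases hv : v ∈ S K ∩ U
    · simp only [hv, Set.indicator_of_mem]
      nlinarith [h2 v hv, h.w_nonneg v]
    · simpa [hv] using mul_nonneg (h.w_nonneg v) (h.defect_nonneg v)
  have h4 := h.defect_sum
  have h5 := h.lower
  have h6 := h.upper
  have h7 := h.s_lower
  have h8 : 0 ≤ 3 * κ - 1 - 3 * η - m := by linarith
  have h9 := mul_le_mul_of_nonneg_left h1 h8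
  have h10 : (3 * κ - 1) * (η + m) ≤ 1 / 8 * (η + m) :=
    mul_le_mul_of_nonneg_right (by linarith) (by linarith)
  have h11 : (3 * s - 1) * (3 * η + m) ≤ 1 / 8 * (3 * η + m) :=
    mul_le_mul_of_nonneg_right (by linarith) (by linarith)
  have h12 : 0 ≤ (η + m) * (3 * η + m) := mul_nonneg (by linarith) (by linarith)
  -- Up to errors the defects give `(3κ - 1)(3s - 1) ≤ κ - s`. The left side minus the right equals
  -- `(3/8 - κ)(4 - 9s) + (11s - 4)/8`, which is positive.
  have h13 : 0 ≤ (3 / 8 - m - κ) * (4 - 9 * s) := mul_nonneg (by linarith) (by linarith)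
  have h14 : m * (5 / 8) ≤ m * (4 - 9 * s) := mul_le_mul_of_nonneg_left (by linarith) (by linarith)
  nlinarith

end IsDual

/-- The indices with few common neighbours with `K` include all neighbours of `K`. If they had mass
above `κ + ε / 2`, the union of suitable members would have mass almost `2 * s`, contradicting
`IsDual.union_le`. This bounds both the degree and the number of sparse non-neighbours. -/
theorem exists_isRegularSystem {m ε : ℝ} (hm : 0 < m) (hε : 0 < ε) :
    ∃ η > 0, ∀ (V Ω : Type) [Fintype V] [Fintype Ω] (H : SimpleGraph V) (w : V → ℝ)
      (S : Ω → Set V) (p : Ω → ℝ) (φ : V → ℝ) (s κ : ℝ), IsDual H w S p φ s κ m η →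
      IsRegularSystem (disjointnessGraph S) p κ m ε := by
  -- After `k` steps the intersection is negligible, uniformly for `κ ≤ 3/8`; the accumulated error
  -- is `6 * k * η + (k + 2) * η = (7 * k + 2) * η`.
  obtain ⟨k, hk⟩ := exists_pow_lt_of_lt_one (show 0 < m / 4 by positivity)
    (show (3 / 8) / (3 / 8 + ε / 2) < 1 by rw [div_lt_one (by positivity)]; linarith)
  obtain ⟨η, hη, hη1, hη2, hη3, hη4⟩ : ∃ η, 0 < η ∧ η ≤ ε / 6 ∧ η ≤ 1 / 100 ∧ η ≤ m / 16 ∧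
      η ≤ m / (4 * (7 * k + 2)) :=
    ⟨min (min (ε / 6) (1 / 100)) (min (m / 16) (m / (4 * (7 * k + 2)))), by positivity,
      (min_le_left _ _).trans (min_le_left _ _), (min_le_left _ _).trans (min_le_right _ _),
      (min_le_right _ _).trans (min_le_left _ _), (min_le_right _ _).trans (min_le_right _ _)⟩
  rw [le_div_iff₀ (by positivity)] at hη4
  refine ⟨η, hη, fun V Ω _ _ H w S p φ s κ h => ?_⟩
  have hadj : ∀ {I J}, (disjointnessGraph S).Adj I J ↔ Disjoint (S I) (S J) :=
    h.adj_iff (by linarith)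
  have hN : ∀ K, (disjointnessGraph S).neighborSet K = {J | Disjoint (S K) (S J)} := fun K => by
    ext J; exact hadj
  have hfree := h.disjointnessGraph_cliqueFree (by linarith)
  have hκ := h.lower
  have hκ' := h.upper
  have key : ∀ K, mass p {I | mass p ({J | Disjoint (S K) (S J)} ∩ {J | Disjoint (S I) (S J)}) ≤ m}
      < κ + ε / 2 := by
    intro K
    by_contra! hcon
    obtain ⟨C, U, -, hU, -, -, hC, hCU⟩ :=
      h.exists_large_union hη.le (by positivity : 0 < ε / 2) hcon (by linarith) k
    have h1 := h.union_le hη.le hm (by linarith) K (U := U) (fun u hu => by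
      obtain ⟨I, hI, hu⟩ := hU u hu
      exact ⟨I, hu, hI⟩)
    have h2 : (κ / (κ + ε / 2)) ^ k ≤ ((3 / 8) / (3 / 8 + ε / 2)) ^ k := by
      refine pow_le_pow_left₀ (div_nonneg (by linarith) (by linarith)) ?_ k
      rw [div_le_div_iff₀ (by linarith) (by linarith)]
      nlinarith
    linarith
  have hsub : ∀ K, (disjointnessGraph S).neighborSet K ⊆
      {I | mass p ({J | Disjoint (S K) (S J)} ∩ {J | Disjoint (S I) (S J)}) ≤ m} := by
    intro K I hI
    have : ({J | Disjoint (S K) (S J)} ∩ {J | Disjoint (S I) (S J)} : Set Ω) = ∅ := by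
      rw [Set.eq_empty_iff_forall_notMem]
      rintro J ⟨h1, h2⟩
      exact cliqueFree_three_iff.1 hfree K I J hI (hadj.2 h1) (hadj.2 h2)
    simp only [Set.mem_ofPred_eq, this, mass_empty]
    exact hm.le
  have hdeg : ∀ K, κ - η ≤ mass p ((disjointnessGraph S).neighborSet K) := fun K => by
    rw [hN]; exact h.degree K
  refine ⟨hfree, h.p_nonneg, h.p_sum, by linarith [h.le_p_sum hη.le], fun K => by linarith [hdeg K],
    fun K => by linarith [key K, mass_mono h.p_nonneg (hsub K)], fun K => ?_, hκ, hκ'⟩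
  have h1 := mass_inter_add_diff p
    {I | mass p ({J | Disjoint (S K) (S J)} ∩ {J | Disjoint (S I) (S J)}) ≤ m}
    ((disjointnessGraph S).neighborSet K)
  rw [Set.inter_eq_right.2 (hsub K)] at h1
  have h2 : {I | ¬ (disjointnessGraph S).Adj K I ∧ mass p ((disjointnessGraph S).neighborSet K ∩
      (disjointnessGraph S).neighborSet I) ≤ m} =
      {I | mass p ({J | Disjoint (S K) (S J)} ∩ {J | Disjoint (S I) (S J)}) ≤ m} \
        (disjointnessGraph S).neighborSet K := by
    ext I
    simp only [hN, Set.mem_ofPred_eq, Set.mem_sdiff, hadj]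
    tauto
  rw [h2]
  linarith [key K, hdeg K]

/-! ### Configurations in a regular system and their exceptional vertices -/

section Mass

variable {α : Type*} [Fintype α]

theorem sum_mass_eq {ι : Type*} [Fintype ι] (p : α → ℝ) (A : ι → Set α)
    [∀ x, DecidablePred fun j => x ∈ A j] :
    ∑ j, mass p (A j) = ∑ x, p x * ((Finset.univ.filter fun j => x ∈ A j).card : ℝ) := by
  simp only [mass]
  rw [Finset.sum_comm]
  refine Finset.sum_congr rfl fun x _ => ?_
  simp only [Set.indicator_apply]
  rw [← Finset.sum_filter, Finset.sum_const, nsmul_eq_mul, mul_comm]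

theorem mass_iUnion_le {ι : Type*} [Fintype ι] {p : α → ℝ} (hp : ∀ x, 0 ≤ p x)
    (A : ι → Set α) : mass p (⋃ i, A i) ≤ ∑ i, mass p (A i) := by
  classical
  rw [sum_mass_eq, mass_eq_sum_mul]
  refine Finset.sum_le_sum fun x _ => mul_le_mul_of_nonneg_left ?_ (hp x)
  by_cases hx : x ∈ ⋃ i, A i
  · obtain ⟨i, hi⟩ := Set.mem_iUnion.1 hx
    simp only [hx, Set.indicator_of_mem, Pi.one_apply]
    have : 0 < (Finset.univ.filter fun j => x ∈ A j).card :=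
      Finset.card_pos.2 ⟨i, by simpa using hi⟩
    exact_mod_cast this
  · simp [hx]

end Mass

/-- Every independent set of `Γ` is contained in an independent set of size `k`, and these are
exactly neighbourhoods of vertices. -/
structure IsNeighborhoodMaximal {ι : Type} (Γ : SimpleGraph ι) (k : ℕ) : Prop where
  card_le : ∀ T : Finset ι, (∀ i ∈ T, ∀ j ∈ T, ¬ Γ.Adj i j) → T.card ≤ k
  eq_neighbors : ∀ T : Finset ι, (∀ i ∈ T, ∀ j ∈ T, ¬ Γ.Adj i j) → T.card = k →
    ∃ j, ∀ i, i ∈ T ↔ Γ.Adj j i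
  extend : ∀ T : Finset ι, (∀ i ∈ T, ∀ j ∈ T, ¬ Γ.Adj i j) → T.card < k →
    ∃ j ∉ T, ∀ i ∈ T, ¬ Γ.Adj j i

section Configuration

variable {Ω ι : Type} (D : SimpleGraph Ω) (p : Ω → ℝ) (B : ι → Ω)

open Classical in
/-- The indices of the members of the configuration `B` adjacent to `I`. -/
noncomputable def trace [Fintype ι] (I : Ω) : Finset ι := Finset.univ.filter fun i => D.Adj I (B i)

/-- The vertices adjacent to all `B i` with `i` a neighbour of `j`. -/
def twins (Γ : SimpleGraph ι) (j : ι) : Set Ω := {I | ∀ i, Γ.Adj j i → D.Adj I (B i)}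

/-- The vertices adjacent to fewer than `k` members of the configuration. -/
def exceptional [Fintype ι] (k : ℕ) : Set Ω := {I | (trace D B I).card < k}

/-- `K` is generic for the configuration `B` if it has many common neighbours with each member of
`B` it is not adjacent to. -/
def IsGeneric [Fintype Ω] (m : ℝ) (K : Ω) : Prop :=
  ∀ i, ¬ D.Adj K (B i) → m < mass p (D.neighborSet K ∩ D.neighborSet (B i))

/-- `K` is adjacent to twins of two adjacent members of the configuration. -/
def IsLinked (Γ : SimpleGraph ι) (K : Ω) : Prop :=
  ∃ j j' X Y, Γ.Adj j j' ∧ X ∈ twins D B Γ j ∧ Y ∈ twins D B Γ j' ∧ D.Adj K X ∧ D.Adj K Y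

variable {D p B}

theorem mem_trace [Fintype ι] {I : Ω} {i : ι} : i ∈ trace D B I ↔ D.Adj I (B i) := by simp [trace]

theorem trace_indep [Fintype ι] {Γ : SimpleGraph ι} (hD : D.CliqueFree 3)
    (hB : ∀ i j, Γ.Adj i j → D.Adj (B i) (B j)) (I : Ω) :
    ∀ i ∈ trace D B I, ∀ j ∈ trace D B I, ¬ Γ.Adj i j := by
  intro i hi j hj hij
  rw [mem_trace] at hi hj
  exact cliqueFree_three_iff.1 hD I _ _ hi hj (hB i j hij)

theorem self_mem_twins {Γ : SimpleGraph ι} (hB : ∀ i j, Γ.Adj i j → D.Adj (B i) (B j)) (j : ι) :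
    B j ∈ twins D B Γ j := fun i hi => hB j i hi

theorem exists_twins_of_notMem_exceptional [Fintype ι] {Γ : SimpleGraph ι} {k : ℕ}
    (hΓ : IsNeighborhoodMaximal Γ k) (hD : D.CliqueFree 3)
    (hB : ∀ i j, Γ.Adj i j → D.Adj (B i) (B j)) {I : Ω} (hI : I ∉ exceptional D B k) :
    ∃ j, ∀ i, D.Adj I (B i) ↔ Γ.Adj j i := by
  have h1 := trace_indep hD hB I
  obtain ⟨j, hj⟩ := hΓ.eq_neighbors _ h1 (le_antisymm (hΓ.card_le _ h1) (not_lt.1 hI))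
  exact ⟨j, fun i => by rw [← hj, mem_trace]⟩

namespace IsRegularSystem

variable [Fintype Ω] [Fintype ι] {κ m ε : ℝ}

theorem sum_degree (D : SimpleGraph Ω) (p : Ω → ℝ) (B : ι → Ω) :
    ∑ i, mass p (D.neighborSet (B i)) = ∑ I, p I * ((trace D B I).card : ℝ) := by
  classical
  rw [sum_mass_eq]
  refine Finset.sum_congr rfl fun I _ => ?_
  congr 3
  ext i
  simp [mem_trace, D.adj_comm]

theorem exists_isGeneric (h : IsRegularSystem D p κ m ε) (B : ι → Ω) {A : Set Ω}
    (hA : Fintype.card ι * ε < mass p A) : ∃ I ∈ A, IsGeneric D p B m I := by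
  by_contra! hcon
  have h1 : A ⊆ ⋃ i, {I | ¬ D.Adj (B i) I ∧
      mass p (D.neighborSet (B i) ∩ D.neighborSet I) ≤ m} := by
    intro I hI
    have h2 := hcon I hI
    rw [IsGeneric] at h2
    push Not at h2
    obtain ⟨i, hi, hi'⟩ := h2
    exact Set.mem_iUnion.2 ⟨i, fun h3 => hi h3.symm, by rwa [Set.inter_comm]⟩
  have h2 := (mass_mono h.p_nonneg h1).trans (mass_iUnion_le h.p_nonneg _)
  have h3 := Finset.sum_le_sum fun i (_ : i ∈ Finset.univ) => h.sparse (B i)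
  simp only [Finset.sum_const, Finset.card_univ, nsmul_eq_mul] at h3
  linarith

/-- Count edges to the configuration: a trace is independent in `Γ`, so it has at most `k` elements,
and fewer at an exceptional vertex. -/
theorem mass_exceptional_le {Γ : SimpleGraph ι} {k : ℕ} (h : IsRegularSystem D p κ m ε)
    (hΓ : IsNeighborhoodMaximal Γ k) (hB : ∀ i j, Γ.Adj i j → D.Adj (B i) (B j)) :
    mass p (exceptional D B k) ≤ k - Fintype.card ι * (κ - ε) := by
  have h1 : ∑ i : ι, (κ - ε) ≤ ∑ i, mass p (D.neighborSet (B i)) :=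
    Finset.sum_le_sum fun i _ => h.le_degree (B i)
  have h2 : ∑ i, mass p (D.neighborSet (B i)) + mass p (exceptional D B k) ≤ k * ∑ I, p I := by
    rw [sum_degree, mass_eq_sum_mul, ← Finset.sum_add_distrib, Finset.mul_sum]
    refine Finset.sum_le_sum fun I _ => ?_
    rw [← mul_add, mul_comm]
    refine mul_le_mul_of_nonneg_right ?_ (h.p_nonneg I)
    have h3 := hΓ.card_le _ (trace_indep h.cliqueFree hB I)
    by_cases hI : I ∈ exceptional D B k
    · simp only [hI, Set.indicator_of_mem, Pi.one_apply]
      have : (trace D B I).card < k := hI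
      exact_mod_cast this
    · simp only [hI, not_false_eq_true, Set.indicator_of_notMem, add_zero]
      exact_mod_cast h3
  simp only [Finset.sum_const, Finset.card_univ, nsmul_eq_mul] at h1
  have : (k : ℝ) * ∑ I, p I ≤ k * 1 := mul_le_mul_of_nonneg_left h.p_sum_le (Nat.cast_nonneg k)
  linarith

theorem le_mass_exceptional (h : IsRegularSystem D p κ m ε) (B : ι → Ω) (k : ℕ) :
    k * (1 - ε) - Fintype.card ι * (κ + ε) ≤ k * mass p (exceptional D B k) := by
  have h1 : ∑ i, mass p (D.neighborSet (B i)) ≤ ∑ i : ι, (κ + ε) :=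
    Finset.sum_le_sum fun i _ => h.degree_le (B i)
  have h2 : k * ∑ I, p I ≤
      ∑ i, mass p (D.neighborSet (B i)) + k * mass p (exceptional D B k) := by
    rw [sum_degree, mass_eq_sum_mul, Finset.mul_sum, Finset.mul_sum, ← Finset.sum_add_distrib]
    refine Finset.sum_le_sum fun I _ => ?_
    rw [mul_left_comm, mul_comm (k : ℝ) (p I), ← mul_add]
    refine mul_le_mul_of_nonneg_left ?_ (h.p_nonneg I)
    by_cases hI : I ∈ exceptional D B k
    · simp [hI]
    · simp only [hI, not_false_eq_true, Set.indicator_of_notMem, mul_zero, add_zero]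
      exact_mod_cast not_lt.1 hI
  simp only [Finset.sum_const, Finset.card_univ, nsmul_eq_mul] at h1
  have : (k : ℝ) * (1 - ε) ≤ k * ∑ I, p I :=
    mul_le_mul_of_nonneg_left h.le_p_sum (Nat.cast_nonneg k)
  linarith

/-- A generic exceptional vertex `K` that is not linked yields another generic exceptional vertex
`L`; if `L` is not linked either, then there are many exceptional vertices. -/
theorem exists_exceptional_neighbor {Γ : SimpleGraph ι} {k : ℕ} (h : IsRegularSystem D p κ m ε)
    (hm : Fintype.card ι * ε ≤ m)
    (hΓ : IsNeighborhoodMaximal Γ k) (hB : ∀ i j, Γ.Adj i j → D.Adj (B i) (B j)) {K : Ω}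
    (hK : K ∈ exceptional D B k) (hKg : IsGeneric D p B m K) (hKl : ¬ IsLinked D B Γ K) :
    ∃ j L, ¬ D.Adj K (B j) ∧ D.Adj L (B j) ∧ L ∈ exceptional D B k ∧ IsGeneric D p B m L ∧
      (¬ IsLinked D B Γ L →
        3 * κ - 1 - 3 * ε ≤ mass p (exceptional D B k ∩ D.neighborSet (B j))) := by
  -- If `K` is adjacent to a twin of some `j` but not to `B j`, that `j` works because `K` is not
  -- linked. Otherwise every index with a twin adjacent to `K` lies in the trace of `K`, and any
  -- index extending this trace independently works.
  obtain ⟨j, hjK, hj⟩ : ∃ j, ¬ D.Adj K (B j) ∧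
      ∀ l X, X ∈ twins D B Γ l → D.Adj K X → ¬ Γ.Adj j l := by
    by_cases hex : ∃ j X, X ∈ twins D B Γ j ∧ D.Adj K X ∧ ¬ D.Adj K (B j)
    · obtain ⟨j, X, hX, hKX, hj⟩ := hex
      exact ⟨j, hj, fun l Y hY hKY hjl => hKl ⟨j, l, X, Y, hjl, hX, hY, hKX, hKY⟩⟩
    · push Not at hex
      obtain ⟨j, hj, hj'⟩ := hΓ.extend _ (trace_indep h.cliqueFree hB K) hK
      exact ⟨j, fun h1 => hj (mem_trace.2 h1),
        fun l X hX hKX hjl => hj' l (mem_trace.2 (hex l X hX hKX)) hjl⟩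
  obtain ⟨L, ⟨hKL, hBL⟩, hLg⟩ := h.exists_isGeneric B (hm.trans_lt (hKg j hjK))
  rw [SimpleGraph.mem_neighborSet] at hKL hBL
  refine ⟨j, L, hjK, hBL.symm, ?_, hLg, fun hLl => ?_⟩
  · by_contra hL
    obtain ⟨l, hl⟩ := exists_twins_of_notMem_exceptional hΓ h.cliqueFree hB hL
    exact hj l L (fun i hi => (hl i).2 hi) hKL ((hl j).1 hBL.symm).symm
  -- A non-exceptional neighbour of `B j` is a twin of some `l` adjacent to `j`. It is not adjacent
  -- to `K` by the choice of `j`, nor to `L`, which would then be linked through `B j`. So three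
  -- almost disjoint neighbourhoods must fit into mass 1.
  · have hd1 : Disjoint (D.neighborSet K) (D.neighborSet L) :=
      Set.disjoint_left.2 fun I hI hI' => cliqueFree_three_iff.1 h.cliqueFree K L I hKL hI hI'
    have hd2 : Disjoint (D.neighborSet K ∪ D.neighborSet L)
        (D.neighborSet (B j) \ exceptional D B k) := by
      rw [Set.disjoint_left]
      rintro I hI ⟨hIB, hIR⟩
      obtain ⟨l, hl⟩ := exists_twins_of_notMem_exceptional hΓ h.cliqueFree hB hIR
      have hlj : Γ.Adj l j := (hl j).1 ((SimpleGraph.mem_neighborSet _ _ _).1 hIB).symm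
      have hIl : I ∈ twins D B Γ l := fun i hi => (hl i).2 hi
      rcases hI with hI | hI
      · exact hj l I hIl hI hlj.symm
      · exact hLl ⟨j, l, B j, I, hlj.symm, self_mem_twins hB j, hIl, hBL.symm, hI⟩
    have h1 := mass_add_le h.p_nonneg hd2
    rw [mass_union_of_disjoint p hd1] at h1
    have h2 := mass_inter_add_diff p (D.neighborSet (B j)) (exceptional D B k)
    rw [Set.inter_comm] at h2
    linarith [h.le_degree K, h.le_degree L, h.le_degree (B j), h.p_sum_le]

end IsRegularSystem

end Configuration

/-! ### Excluding the Wagner graph, the punctured Wagner graph and the pentagon -/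

/-- The cycle of length five. -/
def pentagon : SimpleGraph (Fin 5) where
  Adj i j := j = i + 1 ∨ i = j + 1
  symm := ⟨fun _ _ h => h.symm⟩
  loopless := ⟨by decide⟩

instance : DecidableRel pentagon.Adj := fun i j => inferInstanceAs (Decidable (j = i + 1 ∨ i = j + 1))

/-- The Wagner graph, which is the Andrásfai graph on eight vertices. -/
def wagnerGraph : SimpleGraph (Fin 8) where
  Adj i j := j = i + 3 ∨ j = i + 4 ∨ j = i + 5
  symm := ⟨by decide⟩
  loopless := ⟨by decide⟩

instance : DecidableRel wagnerGraph.Adj := fun i j =>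
  inferInstanceAs (Decidable (j = i + 3 ∨ j = i + 4 ∨ j = i + 5))

/-- The Wagner graph without the edge between `2` and `6`. -/
def puncturedWagnerGraph : SimpleGraph (Fin 8) where
  Adj i j := wagnerGraph.Adj i j ∧ ¬ (i = 2 ∧ j = 6) ∧ ¬ (i = 6 ∧ j = 2)
  symm := ⟨by decide⟩
  loopless := ⟨by decide⟩

instance : DecidableRel puncturedWagnerGraph.Adj := fun i j =>
  inferInstanceAs (Decidable (wagnerGraph.Adj i j ∧ ¬ (i = 2 ∧ j = 6) ∧ ¬ (i = 6 ∧ j = 2)))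

theorem isNeighborhoodMaximal_pentagon : IsNeighborhoodMaximal pentagon 2 := by
  constructor <;> decide +kernel

theorem isNeighborhoodMaximal_wagnerGraph : IsNeighborhoodMaximal wagnerGraph 3 := by
  constructor <;> decide +kernel

theorem card_le_of_indep_puncturedWagnerGraph : ∀ T : Finset (Fin 8),
    (∀ i ∈ T, ∀ j ∈ T, ¬ puncturedWagnerGraph.Adj i j) →
      T.card ≤ 3 ∧ (1 ∈ T → 3 ∈ T → 2 ∉ T → T.card ≤ 2) := by
  decide +kernel

theorem card_common_nonneighbors_wagnerGraph : ∀ j j' : Fin 8, wagnerGraph.Adj j j' →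
    (Finset.univ.filter fun i => ¬ wagnerGraph.Adj j i ∧ ¬ wagnerGraph.Adj j' i).card ≤ 2 := by
  decide +kernel

section Configuration

variable {Ω : Type} [Fintype Ω] {D : SimpleGraph Ω} {p : Ω → ℝ} {κ m ε : ℝ}

namespace IsRegularSystem

/-- Together with `K`, `X`, `Y` the configuration has eleven members. Every vertex sees at most four
of them: one adjacent to both `X` and `Y` misses `K` and has a trace of size at most two. Hence `11
κ ≤ 4` up to errors. -/
theorem not_isLinked_wagnerGraph (h : IsRegularSystem D p κ m ε) (hε : ε < m) {B : Fin 8 → Ω}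
    (hB : ∀ i j, wagnerGraph.Adj i j → D.Adj (B i) (B j)) (K : Ω) :
    ¬ IsLinked D B wagnerGraph K := by
  rintro ⟨j, j', X, Y, hjj, hX, hY, hKX, hKY⟩
  have hD := cliqueFree_three_iff.1 h.cliqueFree
  have h1 : ∑ i : Fin 8, (κ - ε) ≤ ∑ i, mass p (D.neighborSet (B i)) :=
    Finset.sum_le_sum fun i _ => h.le_degree (B i)
  have h2 : ∑ i, mass p (D.neighborSet (B i)) + (mass p (D.neighborSet K) +
      (mass p (D.neighborSet X) + mass p (D.neighborSet Y))) ≤ 4 * ∑ I, p I := by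
    rw [sum_degree]
    simp only [mass_eq_sum_mul]
    simp only [← Finset.sum_add_distrib]
    rw [Finset.mul_sum]
    refine Finset.sum_le_sum fun I _ => ?_
    rw [← mul_add, ← mul_add, ← mul_add, mul_comm]
    refine mul_le_mul_of_nonneg_right ?_ (h.p_nonneg I)
    have h3' := isNeighborhoodMaximal_wagnerGraph.card_le _ (trace_indep h.cliqueFree hB I)
    have h3 : ((trace D B I).card : ℝ) ≤ 3 := by exact_mod_cast h3'
    by_cases hIK : D.Adj K I
    · have hIX : ¬ D.Adj X I := fun hIX => hD K X I hKX hIK hIX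
      have hIY : ¬ D.Adj Y I := fun hIY => hD K Y I hKY hIK hIY
      simp [hIK, hIX, hIY]
      linarith
    · by_cases hIX : D.Adj X I
      · by_cases hIY : D.Adj Y I
        · have h4 : trace D B I ⊆ Finset.univ.filter fun i =>
              ¬ wagnerGraph.Adj j i ∧ ¬ wagnerGraph.Adj j' i := by
            intro i hi
            rw [mem_trace] at hi
            simp only [Finset.mem_filter, Finset.mem_univ, true_and]
            exact ⟨fun hji => hD X I (B i) hIX (hX i hji) hi,
              fun hji => hD Y I (B i) hIY (hY i hji) hi⟩
          have h5 : ((trace D B I).card : ℝ) ≤ 2 := by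
            exact_mod_cast (Finset.card_le_card h4).trans
              (card_common_nonneighbors_wagnerGraph j j' hjj)
          simp [hIK, hIX, hIY]
          linarith
        · simp [hIK, hIX, hIY]
          linarith
      · by_cases hIY : D.Adj Y I
        · simp [hIK, hIX, hIY]
          linarith
        · simp [hIK, hIX, hIY]
          omega
  simp only [Finset.sum_const, Finset.card_univ, Fintype.card_fin, nsmul_eq_mul] at h1
  push_cast at h1
  linarith [h.le_degree K, h.le_degree X, h.le_degree Y, h.p_sum_le, h.lower]

/-- A regular system in the given range of densities does not contain the Wagner graph. -/
theorem not_wagnerGraph (h : IsRegularSystem D p κ m ε) (hε : 0 < ε) (hm : 100 * ε ≤ m)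
    {B : Fin 8 → Ω} (hB : ∀ i j, wagnerGraph.Adj i j → D.Adj (B i) (B j)) : False := by
  have h1 := h.le_mass_exceptional B 3
  have h2 := h.mass_exceptional_le isNeighborhoodMaximal_wagnerGraph hB
  simp only [Fintype.card_fin] at h1 h2
  push_cast at h1 h2
  have hκ := h.lower
  have hκ' := h.upper
  -- Exceptional vertices exist because `8 κ < 3`. Their mass is at most about `3 - 8 κ`, while the
  -- neighbour `L` forces at least `3 κ - 1`.
  obtain ⟨K, hK, hKg⟩ := h.exists_isGeneric B (A := exceptional D B 3)
    (by simp only [Fintype.card_fin]; push_cast; linarith)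
  obtain ⟨j, L, -, -, -, -, hL⟩ := h.exists_exceptional_neighbor
    (by simp only [Fintype.card_fin]; push_cast; linarith) isNeighborhoodMaximal_wagnerGraph hB hK
    hKg (h.not_isLinked_wagnerGraph (by linarith) hB K)
  have h3 := hL (h.not_isLinked_wagnerGraph (by linarith) hB L)
  have h4 := mass_mono h.p_nonneg
    (Set.inter_subset_left (s := exceptional D B 3) (t := D.neighborSet (B j)))
  linarith

/-- A common neighbour of `B 1`, `B 2`, `B 3` could replace `B 6` and complete a Wagner graph.
Without one, the common neighbours of `B 1` and `B 3`, of mass at least about `3 κ - 1`, have traces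
of size at most two, and edge counting gives `8 κ + (3 κ - 1) ≤ 3` up to errors. -/
theorem not_puncturedWagnerGraph (h : IsRegularSystem D p κ m ε) (hε : 0 < ε) (hm : 100 * ε ≤ m)
    {B : Fin 8 → Ω} (hB : ∀ i j, puncturedWagnerGraph.Adj i j → D.Adj (B i) (B j)) : False := by
  have hD := cliqueFree_three_iff.1 h.cliqueFree
  have hκ := h.lower
  have hκ' := h.upper
  obtain ⟨K, h3, h1, h2⟩ : ∃ K, D.Adj (B 3) K ∧ D.Adj (B 1) K ∧ D.Adj (B 2) K := by
    by_contra! hcon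
    have h1 : 3 * κ - 1 - 3 * ε ≤ mass p (D.neighborSet (B 3) ∩ D.neighborSet (B 1)) := by
      have h2 := mass_union_add_inter p (D.neighborSet (B 3)) (D.neighborSet (B 1))
      have h3 := mass_add_le h.p_nonneg (A := D.neighborSet (B 6))
        (B := D.neighborSet (B 3) ∪ D.neighborSet (B 1)) (by
          rw [Set.disjoint_left]
          rintro I hI (hI' | hI')
          · exact hD (B 6) (B 3) I (hB _ _ (by decide)) hI hI'
          · exact hD (B 6) (B 1) I (hB _ _ (by decide)) hI hI')
      linarith [h.le_degree (B 3), h.le_degree (B 1), h.le_degree (B 6), h.p_sum_le]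
    have h2 : ∑ i : Fin 8, (κ - ε) ≤ ∑ i, mass p (D.neighborSet (B i)) :=
      Finset.sum_le_sum fun i _ => h.le_degree (B i)
    have h3 : ∑ i, mass p (D.neighborSet (B i)) +
        mass p (D.neighborSet (B 3) ∩ D.neighborSet (B 1)) ≤ 3 * ∑ I, p I := by
      rw [sum_degree, mass_eq_sum_mul, ← Finset.sum_add_distrib, Finset.mul_sum]
      refine Finset.sum_le_sum fun I _ => ?_
      rw [← mul_add, mul_comm]
      refine mul_le_mul_of_nonneg_right ?_ (h.p_nonneg I)
      obtain ⟨h4, h5⟩ :=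
        card_le_of_indep_puncturedWagnerGraph _ (trace_indep h.cliqueFree hB I)
      by_cases hI : I ∈ D.neighborSet (B 3) ∩ D.neighborSet (B 1)
      · have h6 := h5 (mem_trace.2 (D.adj_symm hI.2)) (mem_trace.2 (D.adj_symm hI.1))
          (fun h7 => hcon I hI.1 hI.2 (D.adj_symm (mem_trace.1 h7)))
        have h7 : ((trace D B I).card : ℝ) ≤ 2 := by exact_mod_cast h6
        simp only [hI, Set.indicator_of_mem, Pi.one_apply]
        linarith
      · simp only [hI, not_false_eq_true, Set.indicator_of_notMem, add_zero]
        exact_mod_cast h4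
    simp only [Finset.sum_const, Finset.card_univ, Fintype.card_fin, nsmul_eq_mul] at h2
    push_cast at h2
    linarith [h.p_sum_le]
  have hpunct : ∀ i j, wagnerGraph.Adj i j → i ≠ 6 → j ≠ 6 → puncturedWagnerGraph.Adj i j := by
    decide
  have hsix : ∀ i, wagnerGraph.Adj 6 i → i ≠ 6 ∧ (i = 1 ∨ i = 2 ∨ i = 3) := by decide
  have hK : ∀ i, wagnerGraph.Adj 6 i → D.Adj K (Function.update B 6 K i) := by
    intro i hi
    obtain ⟨hi6, rfl | rfl | rfl⟩ := hsix i hi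
    · rw [Function.update_of_ne hi6]; exact h1.symm
    · rw [Function.update_of_ne hi6]; exact h2.symm
    · rw [Function.update_of_ne hi6]; exact h3.symm
  refine h.not_wagnerGraph hε hm (B := Function.update B 6 K) fun i j hij => ?_
  by_cases hi : i = 6
  · subst hi
    rw [Function.update_self]
    exact hK j hij
  · by_cases hj : j = 6
    · subst hj
      rw [Function.update_self]
      exact (hK i hij.symm).symm
    · rw [Function.update_of_ne hi, Function.update_of_ne hj]
      exact hB i j (hpunct i j hij hi hj)

theorem not_isLinked_pentagon (h : IsRegularSystem D p κ m ε) (hε : 0 < ε) (hm : 100 * ε ≤ m)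
    {B : Fin 5 → Ω} (hB : ∀ i j, pentagon.Adj i j → D.Adj (B i) (B j)) (K : Ω) :
    ¬ IsLinked D B pentagon K := by
  have key : ∀ j X Y, X ∈ twins D B pentagon j → Y ∈ twins D B pentagon (j + 1) → D.Adj K X →
      D.Adj K Y → False := by
    intro j X Y hX hY hKX hKY
    -- The missing edge between `2` and `6` corresponds to `K` and `B (j + 3)`, about whose
    -- adjacency nothing is known.
    set B' : Fin 8 → Ω := ![B j, B (j + 2), K, B (j + 4), B (j + 1), Y, B (j + 3), X] with hB'
    obtain ⟨p40, p41, p12, p01, p23, p34⟩ : pentagon.Adj j (j + 4) ∧ pentagon.Adj (j + 1) j ∧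
        pentagon.Adj (j + 1) (j + 2) ∧ pentagon.Adj j (j + 1) ∧
        pentagon.Adj (j + 2) (j + 3) ∧ pentagon.Adj (j + 3) (j + 4) := by
      clear hX hY hB'
      revert j
      decide
    have hX1 := hX _ p40
    have hX2 := hX _ p01
    have hY1 := hY _ p41
    have hY2 := hY _ p12
    have h01 := hB _ _ p01
    have h12 := hB _ _ p12
    have h23 := hB _ _ p23
    have h34 := hB _ _ p34
    have h40 := (hB _ _ p40).symm
    have hlt : ∀ a b : Fin 8, a < b → puncturedWagnerGraph.Adj a b →
        (a, b) ∈ ([(0, 3), (1, 4), (2, 5), (3, 6), (4, 7), (0, 4), (1, 5), (3, 7), (0, 5), (1, 6),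
          (2, 7)] : List (Fin 8 × Fin 8)) := by decide
    have hadj : ∀ a b : Fin 8, a < b → puncturedWagnerGraph.Adj a b → D.Adj (B' a) (B' b) := by
      intro a b hab hadj
      have h1 := hlt a b hab hadj
      simp only [List.mem_cons, Prod.mk.injEq, List.not_mem_nil, or_false] at h1
      rcases h1 with ⟨rfl, rfl⟩ | ⟨rfl, rfl⟩ | ⟨rfl, rfl⟩ | ⟨rfl, rfl⟩ | ⟨rfl, rfl⟩ | ⟨rfl, rfl⟩ |
        ⟨rfl, rfl⟩ | ⟨rfl, rfl⟩ | ⟨rfl, rfl⟩ | ⟨rfl, rfl⟩ | ⟨rfl, rfl⟩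
      exacts [h40.symm, h12.symm, hKY, h34.symm, hX2.symm, h01, hY2.symm, hX1.symm, hY1.symm, h23,
        hKX]
    refine h.not_puncturedWagnerGraph hε hm (B := B') fun a b hab => ?_
    rcases lt_trichotomy a b with h1 | h1 | h1
    · exact hadj a b h1 hab
    · exact absurd h1 hab.ne
    · exact (hadj b a h1 hab.symm).symm
  rintro ⟨j, j', X, Y, rfl | rfl, hX, hY, hKX, hKY⟩
  · exact key j X Y hX hY hKX hKY
  · exact key j' Y X hY hX hKY hKX

/-- Passing to an exceptional neighbour twice yields distinct indices `j`, `j'`. An exceptional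
vertex sees at most one member of the configuration, so two disjoint sets of mass about `3 κ - 1`
must fit into mass `2 - 5 κ`. -/
theorem not_pentagon (h : IsRegularSystem D p κ m ε) (hε : 0 < ε) (hm : 100 * ε ≤ m)
    {B : Fin 5 → Ω} (hB : ∀ i j, pentagon.Adj i j → D.Adj (B i) (B j)) : False := by
  have h1 := h.le_mass_exceptional B 2
  have h2 := h.mass_exceptional_le isNeighborhoodMaximal_pentagon hB
  simp only [Fintype.card_fin] at h1 h2
  push_cast at h1 h2
  have hκ := h.lower
  have hκ' := h.upper
  have hcard : (Fintype.card (Fin 5) : ℝ) * ε ≤ m := by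
    simp only [Fintype.card_fin]; push_cast; linarith
  have hlink := h.not_isLinked_pentagon hε hm hB
  obtain ⟨K, hK, hKg⟩ := h.exists_isGeneric B (A := exceptional D B 2)
    (by simp only [Fintype.card_fin]; push_cast; linarith)
  obtain ⟨j, L, -, hLj, hL, hLg, hj⟩ := h.exists_exceptional_neighbor hcard
    isNeighborhoodMaximal_pentagon hB hK hKg (hlink K)
  obtain ⟨j', L', hLj', -, -, -, hj'⟩ := h.exists_exceptional_neighbor hcard
    isNeighborhoodMaximal_pentagon hB hL hLg (hlink L)
  have h3 := hj (hlink L)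
  have h4 := hj' (hlink L')
  have hne : j ≠ j' := by rintro rfl; exact hLj' hLj
  have h5 : Disjoint (exceptional D B 2 ∩ D.neighborSet (B j))
      (exceptional D B 2 ∩ D.neighborSet (B j')) := by
    rw [Set.disjoint_left]
    rintro I ⟨hI, hIj⟩ ⟨-, hIj'⟩
    have h6 : (trace D B I).card < 2 := hI
    have h7 : 1 < (trace D B I).card := Finset.one_lt_card.2
      ⟨j, mem_trace.2 (D.adj_symm hIj), j', mem_trace.2 (D.adj_symm hIj'), hne⟩
    omega
  have h6 := mass_union_of_disjoint p h5
  have h7 := mass_mono h.p_nonneg (Set.union_subset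
    (Set.inter_subset_left (s := exceptional D B 2) (t := D.neighborSet (B j)))
    (Set.inter_subset_left (t := D.neighborSet (B j'))))
  linarith

/-- There is no regular system with parameters in the given range. -/
theorem elim (h : IsRegularSystem D p κ m ε) (hε : 0 < ε) (hm : 100 * ε ≤ m) : False := by
  have hκ := h.lower
  have hκ' := h.upper
  have hp := h.le_p_sum
  obtain ⟨K₀, -⟩ : (Set.univ : Set Ω).Nonempty :=
    nonempty_of_mass_pos (p := p) (by rw [mass_univ]; linarith)
  obtain ⟨K₁, h01⟩ := nonempty_of_mass_pos (p := p) (A := D.neighborSet K₀)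
    (by linarith [h.le_degree K₀])
  rw [SimpleGraph.mem_neighborSet] at h01
  -- The common non-neighbours of `K₀` and `K₁` have mass about `1 - 2 κ > 0`; a generic one closes
  -- up to a pentagon through two common neighbours.
  have hA : Fintype.card (Fin 2) * ε < mass p (D.neighborSet K₀ ∪ D.neighborSet K₁)ᶜ := by
    have h1 := mass_add_compl p (D.neighborSet K₀ ∪ D.neighborSet K₁)
    have h2 := mass_union_le h.p_nonneg (D.neighborSet K₀) (D.neighborSet K₁)
    simp only [Fintype.card_fin]
    push_cast
    linarith [h.degree_le K₀, h.degree_le K₁]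
  obtain ⟨K₃, h3, h3g⟩ := h.exists_isGeneric ![K₀, K₁] hA
  simp only [Set.mem_compl_iff, Set.mem_union, SimpleGraph.mem_neighborSet, not_or] at h3
  obtain ⟨K₄, h34, h04⟩ := nonempty_of_mass_pos
    ((by linarith : (0 : ℝ) < m).trans (h3g 0 fun h' => h3.1 h'.symm))
  obtain ⟨K₂, h32, h12⟩ := nonempty_of_mass_pos
    ((by linarith : (0 : ℝ) < m).trans (h3g 1 fun h' => h3.2 h'.symm))
  have hadj : ∀ i : Fin 5, D.Adj ((![K₀, K₁, K₂, K₃, K₄] : Fin 5 → Ω) i)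
      ((![K₀, K₁, K₂, K₃, K₄] : Fin 5 → Ω) (i + 1)) := by
    intro i
    fin_cases i
    exacts [h01, h12, D.adj_symm h32, h34, D.adj_symm h04]
  refine h.not_pentagon hε hm (B := ![K₀, K₁, K₂, K₃, K₄]) fun i j hij => ?_
  rcases hij with rfl | rfl
  · exact hadj i
  · exact (hadj j).symm

end IsRegularSystem

end Configuration

/-! ### The upper bound, weighted and for edge counts -/

/-- The weighted form of the upper bound. -/
theorem IsWeighted.adjForm_le_density {V : Type} [Fintype V] {H : SimpleGraph V} {w : V → ℝ}
    {s : ℝ} (h : IsWeighted H w s) (hs : 4 / 11 ≤ s) (hs' : s ≤ 3 / 8) :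
    adjForm H w w ≤ density s := by
  by_contra! hcon
  obtain ⟨m, hm, hdual⟩ :=
    exists_isDual (sub_pos.2 hcon) ⟨V, inferInstance, H, w, s, h, hs, hs', rfl⟩
  obtain ⟨η, hη, hreg⟩ := exists_isRegularSystem hm (show 0 < m / 100 by positivity)
  obtain ⟨V', Ω, _, _, H', w', S, p, φ, s', κ, hd⟩ := hdual η hη
  exact (hreg V' Ω H' w' S p φ s' κ hd).elim (by positivity) (by linarith)

theorem mass_const {α : Type*} [Fintype α] (c : ℝ) (A : Set α) :
    mass (fun _ => c) A = A.ncard * c := by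
  classical
  rw [mass]
  simp only [Set.indicator_apply]
  rw [← Finset.sum_filter, Finset.sum_const, nsmul_eq_mul, Set.ncard_eq_toFinset_card']
  congr 3
  ext; simp

/-- The upper bound on the number of edges of a triangle-free graph. -/
theorem ncard_edgeSet_le {n s : ℕ} (G : SimpleGraph (Fin n)) (hG : G.CliqueFree 3)
    (hs : G.indepNum ≤ s) (h1 : 4 * n ≤ 11 * s) (h2 : 8 * s ≤ 3 * n) :
    (G.edgeSet.ncard : ℝ) ≤ 6 * (n : ℝ) ^ 2 - 32 * n * s + 44 * (s : ℝ) ^ 2 := by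
  classical
  rcases Nat.eq_zero_or_pos n with rfl | hn
  · have : s = 0 := by omega
    subst this
    have : G.edgeSet = ∅ := Set.eq_empty_of_isEmpty _
    simp [this]
  have hn' : (0 : ℝ) < n := by exact_mod_cast hn
  have h1' : (4 : ℝ) * n ≤ 11 * s := by exact_mod_cast h1
  have h2' : (8 : ℝ) * s ≤ 3 * n := by exact_mod_cast h2
  obtain ⟨α, hα⟩ := exists_isWeighted hG (w := fun _ => (1 : ℝ) / n) (fun _ => by positivity)
    (by simp [hn'.ne'])
  have hαs : α ≤ s / n := by
    obtain ⟨J, hJ, rfl⟩ := hα.attained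
    rw [mass_const, mul_one_div]
    have h3 : G.IsIndepSet (J.toFinset : Set (Fin n)) := by simpa using hJ
    have h4 := h3.card_le_indepNum
    rw [← Set.ncard_eq_toFinset_card'] at h4
    gcongr
    exact h4.trans hs
  have hE : adjForm G (fun _ => (1 : ℝ) / n) (fun _ => (1 : ℝ) / n) * n ^ 2 =
      2 * G.edgeSet.ncard := by
    have h3 : ∀ v, ((G.neighborSet v).ncard : ℝ) = G.degree v := fun v => by
      rw [Set.ncard_eq_toFinset_card', SimpleGraph.degree, SimpleGraph.neighborFinset]
    have h4 : (∑ v, (G.degree v : ℝ)) = 2 * G.edgeSet.ncard := by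
      rw [Set.ncard_eq_toFinset_card']
      exact_mod_cast G.sum_degrees_eq_twice_card_edges
    simp only [adjForm, mass_const, h3]
    rw [← h4, Finset.sum_mul]
    exact Finset.sum_congr rfl fun v _ => by field_simp
  have hx1 : (4 : ℝ) / 11 ≤ s / n := by rw [le_div_iff₀ hn']; linarith
  have hx2 : (s : ℝ) / n ≤ 3 / 8 := by rw [div_le_iff₀ hn']; linarith
  -- The true ratio `α` may be smaller than `s / n`. Above `4/11` monotonicity of `density`
  -- suffices; below, the trivial bound `α` does, as the minimum of `density` is `4/11`.
  have hle : adjForm G (fun _ => (1 : ℝ) / n) (fun _ => (1 : ℝ) / n) ≤ density (s / n) := by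
    rcases le_or_gt (4 / 11) α with h3 | h3
    · refine (hα.adjForm_le_density h3 (hαs.trans hx2)).trans ?_
      simp only [density]
      nlinarith
    · refine hα.adjForm_le.trans ?_
      simp only [density]
      nlinarith
  have hdens : density (s / n) * n ^ 2 =
      2 * (6 * (n : ℝ) ^ 2 - 32 * n * s + 44 * (s : ℝ) ^ 2) := by
    rw [density]; field_simp; ring
  have := mul_le_mul_of_nonneg_right hle (by positivity : (0 : ℝ) ≤ n ^ 2)
  rw [hE, hdens] at this
  linarith

/-! ### The canonical blow-ups -/

theorem ncard_edgeSet_mem_edgeCounts {V : Type*} [Fintype V] {G : SimpleGraph V} {n s : ℕ}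
    (hn : Fintype.card V = n) (hG : G.CliqueFree 3) (hs : G.indepNum ≤ s) :
    G.edgeSet.ncard ∈ edgeCounts n s := by
  classical
  set e := G.overFinIso hn with he
  refine ⟨G.overFin hn, ?_, ?_, ?_⟩
  · rw [cliqueFree_three_iff] at hG ⊢
    intro a b c hab hac hbc
    exact hG _ _ _ (e.symm.map_adj_iff.2 hab) (e.symm.map_adj_iff.2 hac) (e.symm.map_adj_iff.2 hbc)
  · obtain ⟨T, hT, hTc⟩ := (G.overFin hn).exists_isNIndepSet_indepNum
    rw [← hTc]
    have h1 : G.IsIndepSet (T.map e.symm.toEquiv.toEmbedding : Set V) := by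
      intro x hx y hy hxy hadj
      simp only [Finset.coe_map, Set.mem_image] at hx hy
      obtain ⟨a, ha, rfl⟩ := hx
      obtain ⟨b, hb, rfl⟩ := hy
      exact hT ha hb (fun h => hxy (h ▸ rfl)) (e.symm.map_adj_iff.1 hadj)
    have h2 := h1.card_le_indepNum
    rw [Finset.card_map] at h2
    exact h2.trans hs
  · rw [← Nat.card_coe_set_eq, ← Nat.card_coe_set_eq]
    exact Nat.card_congr e.symm.mapEdgeSet

theorem blowUp_cliqueFree {V : Type*} {G : SimpleGraph V} (hG : G.CliqueFree 3) (m : V → ℕ) :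
    (blowUp G m).CliqueFree 3 := by
  rw [cliqueFree_three_iff] at hG ⊢
  exact fun a b c => hG a.1 b.1 c.1

/-- Adjacency depends only on the projection, so a maximum independent set lies in full classes over
an independent set of `G`. -/
theorem exists_indepNum_blowUp_le {V : Type*} [Fintype V] [DecidableEq V] (G : SimpleGraph V)
    (m : V → ℕ) :
    ∃ T : Finset V, (∀ u ∈ T, ∀ v ∈ T, ¬ G.Adj u v) ∧ (blowUp G m).indepNum ≤ ∑ v ∈ T, m v := by
  obtain ⟨T, hT, hTc⟩ := (blowUp G m).exists_isNIndepSet_indepNum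
  refine ⟨T.image Sigma.fst, ?_, ?_⟩
  · intro u hu v hv huv
    obtain ⟨x, hx, rfl⟩ := Finset.mem_image.1 hu
    obtain ⟨y, hy, rfl⟩ := Finset.mem_image.1 hv
    exact hT hx hy (fun h => huv.ne (h ▸ rfl)) huv
  · rw [← hTc]
    calc T.card ≤ ((T.image Sigma.fst).sigma fun v => (Finset.univ : Finset (Fin (m v)))).card :=
          Finset.card_le_card fun x hx => by
            simpa using ⟨x.2, hx⟩
      _ = _ := by simp

theorem two_mul_ncard_edgeSet_blowUp {V : Type*} [Fintype V] (G : SimpleGraph V)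
    [DecidableRel G.Adj] (m : V → ℕ) :
    2 * (blowUp G m).edgeSet.ncard = ∑ v, m v * ∑ u ∈ Finset.univ.filter (G.Adj v), m u := by
  classical
  have h1 : ∀ x, (blowUp G m).degree x = ∑ u ∈ Finset.univ.filter (G.Adj x.1), m u := by
    intro x
    have : (blowUp G m).neighborFinset x =
        (Finset.univ.filter (G.Adj x.1)).sigma fun v => (Finset.univ : Finset (Fin (m v))) := by
      ext y
      rw [SimpleGraph.mem_neighborFinset]
      simp only [Finset.mem_sigma, Finset.mem_filter, Finset.mem_univ, true_and, and_true]
      rfl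
    rw [SimpleGraph.degree, this]
    simp
  rw [Set.ncard_eq_toFinset_card']
  have h2 := (blowUp G m).sum_degrees_eq_twice_card_edges
  rw [SimpleGraph.edgeFinset] at h2
  rw [← h2, Finset.sum_congr rfl fun x _ => h1 x, Fintype.sum_sigma]
  simp

/-- The Andrásfai graph on eleven vertices. -/
abbrev andrasfaiFour : SimpleGraph (ZMod 11) := andrasfaiGraph 4

theorem andrasfaiFour_adj (u v : ZMod 11) :
    andrasfaiFour.Adj u v ↔ u - v = 4 ∨ u - v = 5 ∨ u - v = 6 ∨ u - v = 7 := by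
  have h1 : ∀ x : ZMod 11, (∃ d ∈ Finset.Icc (4 : ℕ) 7, x = (d : ZMod 11)) ↔
      x = 4 ∨ x = 5 ∨ x = 6 ∨ x = 7 := by
    decide
  have h2 : andrasfaiFour.Adj u v ↔ u ≠ v ∧ ((∃ d ∈ Finset.Icc (4 : ℕ) 7, u - v = (d : ZMod 11)) ∨
      (∃ d ∈ Finset.Icc (4 : ℕ) 7, v - u = (d : ZMod 11))) := Iff.rfl
  rw [h2, h1, h1]
  clear h1 h2
  revert u v
  decide

instance : DecidableRel andrasfaiFour.Adj := fun u v =>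
  decidable_of_iff _ (andrasfaiFour_adj u v).symm

theorem andrasfaiFour_cliqueFree : andrasfaiFour.CliqueFree 3 := by
  rw [cliqueFree_three_iff]
  decide +kernel

theorem card_indep_andrasfaiFour : ∀ T : Finset (ZMod 11),
    (∀ u ∈ T, ∀ v ∈ T, ¬ andrasfaiFour.Adj u v) →
      (T.filter fun v => v = 1 ∨ v = 4 ∨ v = 8).card ≤ 2 ∧
      (T.filter fun v => ¬ (v = 1 ∨ v = 4 ∨ v = 8)).card ≤ 3 ∧
      ((T.filter fun v => v = 1 ∨ v = 4 ∨ v = 8).card = 2 →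
        (T.filter fun v => ¬ (v = 1 ∨ v = 4 ∨ v = 8)).card ≤ 2) := by
  decide +kernel

theorem canonicalSize_four (n s : ℕ) (v : ZMod 11) :
    canonicalSize n 4 s v = if v = 1 ∨ v = 4 ∨ v = 8 then 3 * n - 8 * s else 3 * s - n := by
  have h4 : ((4 : ℕ) : ZMod 11) = 4 := rfl
  have h8 : ((2 * 4 : ℕ) : ZMod 11) = 8 := rfl
  have h : canonicalSize n 4 s v = if v = 1 ∨ v = ((4 : ℕ) : ZMod 11) ∨
      v = ((2 * 4 : ℕ) : ZMod 11) then (((4 : ℕ) - 1 : ℤ) * n - (3 * (4 : ℕ) - 4) * s).toNat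
      else (3 * (s : ℤ) - n).toNat := rfl
  rw [h, h4, h8]
  split_ifs <;> omega

section CanonicalBlowUp

variable {n s : ℕ}

theorem card_canonicalBlowUp (h1 : 4 * n ≤ 11 * s) (h2 : 8 * s ≤ 3 * n) :
    Fintype.card (Σ v : ZMod 11, Fin (canonicalSize n 4 s v)) = n := by
  rw [Fintype.card_sigma]
  simp only [Fintype.card_fin, canonicalSize_four]
  rw [Finset.sum_ite, Finset.sum_const, Finset.sum_const, smul_eq_mul, smul_eq_mul]
  have h3 : (Finset.univ.filter fun v : ZMod 11 => v = 1 ∨ v = 4 ∨ v = 8).card = 3 := by decide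
  have h4 : (Finset.univ.filter fun v : ZMod 11 => ¬ (v = 1 ∨ v = 4 ∨ v = 8)).card = 8 := by decide
  rw [h3, h4]
  omega

theorem indepNum_canonicalBlowUp_le (h1 : 4 * n ≤ 11 * s) (h2 : 8 * s ≤ 3 * n) :
    (canonicalBlowUp n 4 s).indepNum ≤ s := by
  obtain ⟨T, hT, hle⟩ := exists_indepNum_blowUp_le andrasfaiFour
    (fun v : ZMod 11 => canonicalSize n 4 s v)
  refine hle.trans ?_
  obtain ⟨h3, h4, h5⟩ := card_indep_andrasfaiFour T hT
  simp only [canonicalSize_four]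
  rw [Finset.sum_ite, Finset.sum_const, Finset.sum_const, smul_eq_mul, smul_eq_mul]
  generalize (T.filter fun v => v = 1 ∨ v = 4 ∨ v = 8).card = a at *
  generalize (T.filter fun v => ¬ (v = 1 ∨ v = 4 ∨ v = 8)).card = b at *
  clear hT hle
  obtain ⟨x, hx⟩ : ∃ x, 3 * n - 8 * s = x := ⟨_, rfl⟩
  obtain ⟨y, hy⟩ : ∃ y, 3 * s - n = y := ⟨_, rfl⟩
  rw [hx, hy]
  -- The binding cases are `x + 3 * y = s` and `2 * x + 2 * y = 4 * n - 10 * s`, the latter being at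
  -- most `s` exactly when `4 * n ≤ 11 * s`.
  interval_cases a <;> interval_cases b <;> omega

theorem ncard_edgeSet_canonicalBlowUp (h1 : 4 * n ≤ 11 * s) (h2 : 8 * s ≤ 3 * n) :
    ((canonicalBlowUp n 4 s).edgeSet.ncard : ℤ) = 6 * n ^ 2 - 32 * n * s + 44 * s ^ 2 := by
  have h3 := two_mul_ncard_edgeSet_blowUp andrasfaiFour
    (fun v : ZMod 11 => canonicalSize n 4 s v)
  have hx : ((3 * n - 8 * s : ℕ) : ℤ) = 3 * n - 8 * s := by omega
  have hy : ((3 * s - n : ℕ) : ℤ) = 3 * s - n := by omega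
  simp only [canonicalSize_four] at h3
  generalize 3 * n - 8 * s = x at *
  generalize 3 * s - n = y at *
  have h4 : ∀ v : ZMod 11, ∑ u ∈ Finset.univ.filter (andrasfaiFour.Adj v),
      (if u = 1 ∨ u = 4 ∨ u = 8 then x else y) =
      (Finset.univ.filter fun u => andrasfaiFour.Adj v u ∧ (u = 1 ∨ u = 4 ∨ u = 8)).card * x +
      (Finset.univ.filter fun u => andrasfaiFour.Adj v u ∧ ¬ (u = 1 ∨ u = 4 ∨ u = 8)).card * y := by
    intro v
    rw [Finset.sum_ite, Finset.sum_const, Finset.sum_const, smul_eq_mul, smul_eq_mul,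
      Finset.filter_filter, Finset.filter_filter]
  have h5 : ∀ v : ZMod 11, (if v = 1 ∨ v = 4 ∨ v = 8 then x else y) *
      ∑ u ∈ Finset.univ.filter (andrasfaiFour.Adj v), (if u = 1 ∨ u = 4 ∨ u = 8 then x else y) =
      (if v = 1 ∨ v = 4 ∨ v = 8 then (Finset.univ.filter fun u =>
        andrasfaiFour.Adj v u ∧ (u = 1 ∨ u = 4 ∨ u = 8)).card else 0) * (x * x) +
      (if v = 1 ∨ v = 4 ∨ v = 8 then (Finset.univ.filter fun u =>
        andrasfaiFour.Adj v u ∧ ¬ (u = 1 ∨ u = 4 ∨ u = 8)).card else (Finset.univ.filter fun u =>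
        andrasfaiFour.Adj v u ∧ (u = 1 ∨ u = 4 ∨ u = 8)).card) * (x * y) +
      (if v = 1 ∨ v = 4 ∨ v = 8 then 0 else (Finset.univ.filter fun u =>
        andrasfaiFour.Adj v u ∧ ¬ (u = 1 ∨ u = 4 ∨ u = 8)).card) * (y * y) := by
    intro v
    rw [h4]
    split_ifs <;> ring
  rw [Finset.sum_congr rfl fun v _ => h5 v, Finset.sum_add_distrib, Finset.sum_add_distrib,
    ← Finset.sum_mul, ← Finset.sum_mul, ← Finset.sum_mul] at h3
  -- The numbers 4, 16 and 24 count ordered adjacent pairs with two, one or no entries in `{1, 4,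
  -- 8}`.
  have h6 : (∑ v : ZMod 11, if v = 1 ∨ v = 4 ∨ v = 8 then (Finset.univ.filter fun u =>
      andrasfaiFour.Adj v u ∧ (u = 1 ∨ u = 4 ∨ u = 8)).card else 0) = 4 := by decide +kernel
  have h7 : (∑ v : ZMod 11, if v = 1 ∨ v = 4 ∨ v = 8 then (Finset.univ.filter fun u =>
      andrasfaiFour.Adj v u ∧ ¬ (u = 1 ∨ u = 4 ∨ u = 8)).card else (Finset.univ.filter fun u =>
      andrasfaiFour.Adj v u ∧ (u = 1 ∨ u = 4 ∨ u = 8)).card) = 16 := by decide +kernel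
  have h8 : (∑ v : ZMod 11, if v = 1 ∨ v = 4 ∨ v = 8 then 0 else (Finset.univ.filter fun u =>
      andrasfaiFour.Adj v u ∧ ¬ (u = 1 ∨ u = 4 ∨ u = 8)).card) = 24 := by decide +kernel
  rw [h6, h7, h8] at h3
  have h9 : (2 : ℤ) * (canonicalBlowUp n 4 s).edgeSet.ncard =
      4 * (x * x) + 16 * (x * y) + 24 * (y * y) := by exact_mod_cast h3
  rw [hx, hy] at h9
  linarith

theorem isExtremal_canonicalBlowUp (h1 : 4 * n ≤ 11 * s) (h2 : 8 * s ≤ 3 * n) :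
    (ex n s : ℚ) = 6 * (n : ℚ) ^ 2 - 32 * n * s + 44 * (s : ℚ) ^ 2 ∧
      IsExtremal (canonicalBlowUp n 4 s) n s := by
  have hcard := card_canonicalBlowUp h1 h2
  have hfree : (canonicalBlowUp n 4 s).CliqueFree 3 :=
    blowUp_cliqueFree andrasfaiFour_cliqueFree _
  have hind := indepNum_canonicalBlowUp_le h1 h2
  have hedges := ncard_edgeSet_canonicalBlowUp h1 h2
  have hmem : (canonicalBlowUp n 4 s).edgeSet.ncard ∈ edgeCounts n s :=
    ncard_edgeSet_mem_edgeCounts (V := Σ v : ZMod 11, Fin (canonicalSize n 4 s v)) hcard hfree hind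
  obtain ⟨⟨G, hG, hGs, hGe⟩, hmax⟩ := isGreatest_ex ⟨_, hmem⟩
  have hle : (canonicalBlowUp n 4 s).edgeSet.ncard ≤ ex n s := hmax hmem
  have hupper := ncard_edgeSet_le G hG hGs h1 h2
  rw [hGe] at hupper
  have hedges' : ((canonicalBlowUp n 4 s).edgeSet.ncard : ℝ) =
      6 * (n : ℝ) ^ 2 - 32 * n * s + 44 * (s : ℝ) ^ 2 := by exact_mod_cast hedges
  rw [← hedges'] at hupper
  have heq : (canonicalBlowUp n 4 s).edgeSet.ncard = ex n s :=
    le_antisymm hle (by exact_mod_cast hupper)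
  refine ⟨?_, ⟨inferInstanceAs (Finite (Σ v : ZMod 11, Fin (canonicalSize n 4 s v))), ?_, hfree,
    hind, heq⟩⟩
  · rw [← heq]
    exact_mod_cast hedges
  · exact (Nat.card_eq_fintype_card (α := Σ v : ZMod 11, Fin (canonicalSize n 4 s v))).trans hcard

theorem g_four (n s : ℕ) : g 4 n s = 6 * (n : ℚ) ^ 2 - 32 * n * s + 44 * (s : ℚ) ^ 2 := by
  rw [g]
  push_cast
  ring

end CanonicalBlowUp

end RamseyTuran

theorem theorem1p2 :
    (∀ n s : ℕ, (4 : ℚ) * n / 11 ≤ s → (s : ℚ) ≤ 3 * n / 8 →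
      (RamseyTuran.ex n s : ℚ) = RamseyTuran.g 4 n s ∧
      RamseyTuran.g 4 n s = 6 * (n : ℚ) ^ 2 - 32 * n * s + 44 * (s : ℚ) ^ 2 ∧
      RamseyTuran.IsExtremal (RamseyTuran.canonicalBlowUp n 4 s) n s) ∧
    RamseyTuran.AndrasfaiConjectureFor 4 := by
  have key : ∀ n s : ℕ, (4 : ℚ) * n / 11 ≤ s → (s : ℚ) ≤ 3 * n / 8 →
      (RamseyTuran.ex n s : ℚ) = RamseyTuran.g 4 n s ∧
      RamseyTuran.g 4 n s = 6 * (n : ℚ) ^ 2 - 32 * n * s + 44 * (s : ℚ) ^ 2 ∧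
      RamseyTuran.IsExtremal (RamseyTuran.canonicalBlowUp n 4 s) n s := by
    intro n s h1 h2
    rw [div_le_iff₀ (by norm_num), mul_comm (s : ℚ)] at h1
    rw [le_div_iff₀ (by norm_num), mul_comm (s : ℚ)] at h2
    obtain ⟨h3, h4⟩ := RamseyTuran.isExtremal_canonicalBlowUp (n := n) (s := s)
      (by exact_mod_cast h1) (by exact_mod_cast h2)
    exact ⟨h3.trans (RamseyTuran.g_four n s).symm, RamseyTuran.g_four n s, h4⟩
  refine ⟨key, fun n s h1 h2 => (key n s ?_ ?_).1⟩
  · norm_num at h1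
    linarith
  · norm_num at h2
    linarith
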